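/- Let $N\ge 1$ be an integer and $\mathbb{R}^N_+:=\{x\in\mathbb{R}^N: x_N>0\}$. Put $E(r):=(2\pi)^{-N/2}r^{(2-N)/2}K_{(N-2)/2}(r)$ for $r>0$, where $K_\nu$ is the modified Bessel function of the second kind of order $\nu$ (so $E(|x|)$ is the fundamental solution of $-\Delta+1$ on $\mathbb{R}^N$), let $x^*:=(x_1,\ldots,x_{N-1},-x_N)$, and let $$G(x,y):=E(|x-y|)-E(|x^*-y|)\quad (x,y\in\mathbb{R}^N_+,\ x\ne y),\qquad G[f](x):=\int_{\mathbb{R}^N_+}G(x,y)f(y)\,dy$$ be the Dirichlet--Green kernel and the Green operator of $-\Delta+1$ on $\mathbb{R}^N_+$. Let $h(t):=\min\{t,1\}$ for $t>0$, and for $q\in[1,\infty)$, $\alpha\in\mathbb{R}$ let $$L^q_\alpha:=\{f\in L^q_{\mathrm{loc}}(\mathbb{R}^N_+): h(x_N)^\alpha f\in L^q(\mathbb{R}^N_+)\},\qquad \|f\|_{L^q_\alpha}:=\left(\int_{\mathbb{R}^N_+}|f(x)|^q h(x_N)^{q\alpha}\,dx\right)^{1/q},$$ where functions are real-valued. **Proposition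 2.1.** Let $1<q\le r<\infty$ and $\alpha,\beta\in\mathbb{R}$ be such that $$\frac1q+\alpha<2,\qquad \frac1r+\beta>-1,\qquad \frac1q-\frac1r<\frac2N,\qquad \frac Nr+\beta\ge\frac Nq+\alpha-2.$$ Then there is a constant $C>0$, depending only on $N,q,r,\alpha,\beta$, such that for every $f\in L^q_\alpha$ the integral defining $G[f](x)$ converges absolutely for almost every $x\in\mathbb{R}^N_+$, and $$G[f]\in L^r_\beta,\qquad \|G[f]\|_{L^r_\beta}\le C\|f\|_{L^q_\alpha}.$$ -/

import Mathlib

open MeasureTheory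

noncomputable section

namespace HalfSpaceGreen

/-- The index of the last coordinate `x_N` of a point of `ℝ^N`, `N ≥ 1`. -/
def lastIdx (N : ℕ) [NeZero N] : Fin N :=
  ⟨N - 1, Nat.sub_lt (NeZero.pos N) Nat.one_pos⟩

/-- The open half space `{x ∈ ℝ^N : x_N > 0}`. -/
def halfSpace (N : ℕ) [NeZero N] : Set (EuclideanSpace ℝ (Fin N)) :=
  {x | 0 < x (lastIdx N)}

/-- The reflected point `x^* = (x_1, …, x_{N-1}, -x_N)`. -/
def reflect {N : ℕ} [NeZero N] (x : EuclideanSpace ℝ (Fin N)) : EuclideanSpace ℝ (Fin N) :=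
  WithLp.toLp 2 (fun i => if i = lastIdx N then -x i else x i)

/-- The modified Bessel function of the second kind `K_ν(r)` of real order `ν` at `r > 0`,
`K_ν(r) = ∫_0^∞ exp(-r cosh t) cosh(ν t) dt`. -/
def besselK (ν r : ℝ) : ℝ :=
  ∫ t in Set.Ioi (0 : ℝ), Real.exp (-(r * Real.cosh t)) * Real.cosh (ν * t)

/-- The (radial) fundamental solution of `-Δ + 1` on `ℝ^N`,
`E(r) = (2π)^{-N/2} r^{(2-N)/2} K_{(N-2)/2}(r)` for `r > 0`. -/
def fundSol (N : ℕ) (r : ℝ) : ℝ :=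
  (2 * Real.pi) ^ (-(N : ℝ) / 2) * r ^ ((2 - (N : ℝ)) / 2) * besselK (((N : ℝ) - 2) / 2) r

/-- The Dirichlet--Green kernel `G(x, y) = E(|x - y|) - E(|x^* - y|)` of `-Δ + 1` on the
half space, for `x ≠ y`. (The value on the diagonal, a null set, is irrelevant.) -/
def greenKernel {N : ℕ} [NeZero N] (x y : EuclideanSpace ℝ (Fin N)) : ℝ :=
  fundSol N ‖x - y‖ - fundSol N ‖reflect x - y‖

/-- The Green operator `G[f](x) = ∫_{x_N > 0} G(x, y) f(y) dy`. -/
def greenOp {N : ℕ} [NeZero N] (f : EuclideanSpace ℝ (Fin N) → ℝ)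
    (x : EuclideanSpace ℝ (Fin N)) : ℝ :=
  ∫ y in halfSpace N, greenKernel x y * f y

/-- The weight function `h(t) = t` for `0 < t < 1` and `h(t) = 1` for `t ≥ 1`. -/
def h (t : ℝ) : ℝ := min t 1

/-- Membership in the weighted space `L^q_α`: `f ∈ L^q_loc` of the open half space, and
`h(x_N)^α f ∈ L^q` of the half space. -/
def MemLqWeighted {N : ℕ} [NeZero N] (q α : ℝ) (f : EuclideanSpace ℝ (Fin N) → ℝ) : Prop :=
  (∀ K : Set (EuclideanSpace ℝ (Fin N)), IsCompact K → K ⊆ halfSpace N →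
      MemLp f (ENNReal.ofReal q) (volume.restrict K)) ∧
    MemLp (fun x => h (x (lastIdx N)) ^ α * f x) (ENNReal.ofReal q)
      (volume.restrict (halfSpace N))

/-- The norm of `L^q_α`, `(∫_{x_N > 0} |f(x)|^q h(x_N)^{qα} dx)^{1/q}`. -/
def lqNorm {N : ℕ} [NeZero N] (q α : ℝ) (f : EuclideanSpace ℝ (Fin N) → ℝ) : ℝ :=
  (∫ x in halfSpace N, |f x| ^ q * h (x (lastIdx N)) ^ (q * α)) ^ (1 / q)

end HalfSpaceGreen

end

namespace HalfSpaceGreen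

lemma exists_rpow_mul_exp_neg_le {k δ : ℝ} (hk : 0 ≤ k) (hδ : 0 < δ) :
    ∃ C : ℝ, 0 < C ∧ ∀ s : ℝ, 0 < s → s ^ k * Real.exp (-(δ * s)) ≤ C := by
  obtain ⟨n, hn⟩ := exists_nat_ge k
  refine ⟨1 + n.factorial / δ ^ n, by positivity, fun s hs => ?_⟩
  have h1 : s ^ k ≤ 1 + s ^ n := by
    rcases le_total s 1 with h | h
    · have := Real.rpow_le_one hs.le h hk
      have : 0 < s ^ n := by positivity
      linarith
    · have := Real.rpow_le_rpow_of_exponent_le h hn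
      rw [Real.rpow_natCast] at this
      linarith
  have h2 := Real.pow_div_factorial_le_exp (δ * s) (by positivity) n
  rw [Real.exp_neg, ← div_eq_mul_inv, div_le_iff₀ (Real.exp_pos _)]
  refine h1.trans ?_
  have h3 : 1 ≤ Real.exp (δ * s) := Real.one_le_exp (by positivity)
  have h4 : s ^ n = n.factorial / δ ^ n * ((δ * s) ^ n / n.factorial) := by
    field_simp
    rw [mul_pow]; ring
  rw [h4, add_mul, one_mul]
  gcongr

/-- Integrability of the inverse-Gamma density. -/
lemma integrableOn_rpow_mul_exp_neg_div {p c : ℝ} (hp : 0 < p) (hc : 0 < c) :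
    IntegrableOn (fun s : ℝ => s ^ (-1 - p) * Real.exp (-(c / s))) (Set.Ioi 0) := by
  have h1 : IntegrableOn (fun x : ℝ => x ^ (p - 1) * Real.exp (-c * x ^ (1 : ℝ))) (Set.Ioi 0) :=
    integrableOn_rpow_mul_exp_neg_mul_rpow (by linarith) one_pos hc
  rw [← integrableOn_Ioi_comp_rpow_iff _ (p := -1) (by norm_num)] at h1
  refine h1.congr_fun (fun s hs => ?_) measurableSet_Ioi
  have hs : 0 < s := hs
  simp only [smul_eq_mul, abs_neg, abs_one, one_mul, Real.rpow_one]
  rw [← Real.rpow_mul hs.le, ← mul_assoc, ← Real.rpow_add hs, Real.rpow_neg_one]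
  congr 2 <;> ring

/-- The (unnormalised) density of the subordination of `(1 - Δ)⁻¹` to the heat semigroup. -/
noncomputable def heatDensity (a ρ s : ℝ) : ℝ := s ^ (-a) * Real.exp (-(s + ρ ^ 2 / (4 * s)))

lemma heatDensity_nonneg {a ρ s : ℝ} (hs : 0 < s) : 0 ≤ heatDensity a ρ s := by
  unfold heatDensity; positivity

lemma measurable_heatDensity (a ρ : ℝ) : Measurable (heatDensity a ρ) := by
  unfold heatDensity; fun_prop

lemma integrableOn_heatDensity (a : ℝ) {ρ : ℝ} (hρ : 0 < ρ) :
    IntegrableOn (heatDensity a ρ) (Set.Ioi 0) := by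
  set p := max 1 (a - 1)
  have hp : 0 < p := lt_max_of_lt_left one_pos
  have hp' : a - 1 ≤ p := le_max_right _ _
  obtain ⟨C, hC, hb⟩ := exists_rpow_mul_exp_neg_le (k := 1 + p - a) (δ := 1) (by linarith) one_pos
  refine Integrable.mono' ((integrableOn_rpow_mul_exp_neg_div hp
    (c := ρ ^ 2 / 4) (by positivity)).const_mul C)
    (measurable_heatDensity a ρ).aestronglyMeasurable ?_
  refine (ae_restrict_iff' measurableSet_Ioi).2 (Filter.Eventually.of_forall fun s hs => ?_)
  have hs : 0 < s := hs
  rw [Real.norm_of_nonneg (heatDensity_nonneg hs)]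
  have h1 : heatDensity a ρ s = (s ^ (1 + p - a) * Real.exp (-(1 * s))) *
      (s ^ (-1 - p) * Real.exp (-(ρ ^ 2 / 4 / s))) := by
    rw [heatDensity, mul_mul_mul_comm, ← Real.rpow_add hs, ← Real.exp_add]
    congr 2
    · ring
    · field_simp
      ring
  rw [h1]
  exact mul_le_mul_of_nonneg_right (hb s hs) (by positivity)

lemma image_half_mul_exp {ρ : ℝ} (hρ : 0 < ρ) :
    (fun t : ℝ => ρ / 2 * Real.exp t) '' Set.univ = Set.Ioi 0 := by
  ext s
  simp only [Set.image_univ, Set.mem_range, Set.mem_Ioi]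
  constructor
  · rintro ⟨t, rfl⟩; positivity
  · intro hs
    refine ⟨Real.log (2 * s / ρ), ?_⟩
    rw [Real.exp_log (by positivity)]
    field_simp

lemma heatDensity_comp_exp (a : ℝ) {ρ : ℝ} (hρ : 0 < ρ) (t : ℝ) :
    |ρ / 2 * Real.exp t| • heatDensity a ρ (ρ / 2 * Real.exp t) =
      (ρ / 2) ^ (1 - a) * (Real.exp (-(ρ * Real.cosh t)) * Real.exp ((1 - a) * t)) := by
  have hpos : 0 < ρ / 2 * Real.exp t := by positivity
  rw [abs_of_pos hpos, smul_eq_mul, heatDensity, ← mul_assoc]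
  have h1 : ρ / 2 * Real.exp t * (ρ / 2 * Real.exp t) ^ (-a) =
      (ρ / 2) ^ (1 - a) * Real.exp ((1 - a) * t) := by
    rw [mul_comm (1 - a) t, Real.exp_mul, ← Real.mul_rpow (by positivity) (by positivity),
      sub_eq_add_neg, Real.rpow_add hpos, Real.rpow_one]
  have h2 : ρ / 2 * Real.exp t + ρ ^ 2 / (4 * (ρ / 2 * Real.exp t)) = ρ * Real.cosh t := by
    rw [Real.cosh_eq, Real.exp_neg]
    field_simp
    ring
  rw [h1, h2]; ring

lemma hasDerivWithinAt_half_mul_exp (ρ : ℝ) : ∀ t ∈ (Set.univ : Set ℝ),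
    HasDerivWithinAt (fun t : ℝ => ρ / 2 * Real.exp t) (ρ / 2 * Real.exp t) Set.univ t :=
  fun t _ => ((Real.hasDerivAt_exp t).const_mul _).hasDerivWithinAt

lemma injOn_half_mul_exp {ρ : ℝ} (hρ : 0 < ρ) :
    Set.InjOn (fun t : ℝ => ρ / 2 * Real.exp t) Set.univ := by
  intro s _ t _ hst
  have : ρ / 2 ≠ 0 := by positivity
  exact Real.exp_injective (mul_left_cancel₀ this hst)

lemma integrable_exp_neg_mul_cosh_mul_exp (ν : ℝ) {ρ : ℝ} (hρ : 0 < ρ) :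
    Integrable (fun t : ℝ => Real.exp (-(ρ * Real.cosh t)) * Real.exp (ν * t)) := by
  have h1 := integrableOn_heatDensity (1 - ν) hρ
  rw [← image_half_mul_exp hρ, integrableOn_image_iff_integrableOn_abs_deriv_smul
    MeasurableSet.univ (hasDerivWithinAt_half_mul_exp ρ) (injOn_half_mul_exp hρ),
    integrableOn_univ] at h1
  simp only [heatDensity_comp_exp _ hρ, sub_sub_cancel] at h1
  have h2 := h1.const_mul ((ρ / 2) ^ ν)⁻¹
  refine h2.congr (Filter.Eventually.of_forall fun t => ?_)
  have : (ρ / 2) ^ ν ≠ 0 := by positivity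
  simp only
  field_simp

lemma two_mul_besselK (ν : ℝ) {ρ : ℝ} (hρ : 0 < ρ) :
    2 * besselK ν ρ = ∫ t : ℝ, Real.exp (-(ρ * Real.cosh t)) * Real.exp (-ν * t) := by
  have hi := integrable_exp_neg_mul_cosh_mul_exp ν hρ
  have hi' := integrable_exp_neg_mul_cosh_mul_exp (-ν) hρ
  have hsym : ∫ t : ℝ, Real.exp (-(ρ * Real.cosh t)) * Real.exp (ν * t) =
      ∫ t : ℝ, Real.exp (-(ρ * Real.cosh t)) * Real.exp (-ν * t) := by
    rw [← integral_neg_eq_self]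
    simp [Real.cosh_neg]
  have h1 := integral_comp_abs
    (f := fun t => Real.exp (-(ρ * Real.cosh t)) * Real.cosh (ν * t))
  have h2 : ∀ t : ℝ, Real.exp (-(ρ * Real.cosh |t|)) * Real.cosh (ν * |t|) =
      (1 / 2) * (Real.exp (-(ρ * Real.cosh t)) * Real.exp (ν * t) +
        Real.exp (-(ρ * Real.cosh t)) * Real.exp (-ν * t)) := by
    intro t
    have : Real.cosh (ν * |t|) = Real.cosh (ν * t) := by
      rw [← Real.cosh_abs, abs_mul, abs_abs, ← abs_mul, Real.cosh_abs]
    rw [Real.cosh_abs, this, Real.cosh_eq (ν * t), neg_mul]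
    ring
  rw [besselK, ← h1]
  simp only [h2]
  rw [integral_const_mul, integral_add hi hi', hsym]
  ring

/-- Subordination formula: the fundamental solution is a superposition of heat kernels. -/
lemma fundSol_eq_integral_heatDensity (N : ℕ) {ρ : ℝ} (hρ : 0 < ρ) :
    fundSol N ρ =
      (4 * Real.pi) ^ (-(N : ℝ) / 2) * ∫ s in Set.Ioi 0, heatDensity ((N : ℝ) / 2) ρ s := by
  have h1 := integral_image_eq_integral_abs_deriv_smul
    MeasurableSet.univ (hasDerivWithinAt_half_mul_exp ρ) (injOn_half_mul_exp hρ)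
    (heatDensity ((N : ℝ) / 2) ρ)
  rw [image_half_mul_exp hρ, setIntegral_univ] at h1
  simp only [heatDensity_comp_exp _ hρ] at h1
  have h2 := two_mul_besselK (((N : ℝ) - 2) / 2) hρ
  have h3 : -(((N : ℝ) - 2) / 2) = 1 - (N : ℝ) / 2 := by ring
  rw [h3] at h2
  rw [integral_const_mul, ← h2] at h1
  have h4 : (4 * Real.pi) ^ (-(N : ℝ) / 2) =
      2 ^ (-(N : ℝ) / 2) * (2 * Real.pi) ^ (-(N : ℝ) / 2) := by
    rw [← Real.mul_rpow two_pos.le (by positivity)]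
    congr 1; ring
  have h5 : (2 : ℝ) ^ (1 - (N : ℝ) / 2) = 2 ^ (-(N : ℝ) / 2) * 2 := by
    rw [show (1 - (N : ℝ) / 2) = -(N : ℝ) / 2 + 1 by ring, Real.rpow_add two_pos, Real.rpow_one]
  rw [h1, fundSol, Real.div_rpow hρ.le two_pos.le, h4, h5,
    show (2 - (N : ℝ)) / 2 = 1 - (N : ℝ) / 2 by ring]
  have : (2 : ℝ) ^ (-(N : ℝ) / 2) ≠ 0 := by positivity
  generalize (2 : ℝ) ^ (-(N : ℝ) / 2) = A at *
  generalize (2 * Real.pi) ^ (-(N : ℝ) / 2) = B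
  field_simp

variable {N : ℕ} [NeZero N]

lemma norm_reflect_sub_sq (x y : EuclideanSpace ℝ (Fin N)) :
    ‖reflect x - y‖ ^ 2 = ‖x - y‖ ^ 2 + 4 * (x (lastIdx N) * y (lastIdx N)) := by
  rw [EuclideanSpace.norm_sq_eq, EuclideanSpace.norm_sq_eq,
    ← Finset.add_sum_erase _ _ (Finset.mem_univ (lastIdx N)),
    ← Finset.add_sum_erase (a := lastIdx N) _ (fun i => ‖(x - y) i‖ ^ 2) (Finset.mem_univ _)]
  have : ∑ i ∈ Finset.univ.erase (lastIdx N), ‖(reflect x - y) i‖ ^ 2 =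
      ∑ i ∈ Finset.univ.erase (lastIdx N), ‖(x - y) i‖ ^ 2 :=
    Finset.sum_congr rfl fun i hi => by simp [reflect, Finset.ne_of_mem_erase hi]
  rw [this]
  simp only [PiLp.sub_apply, Real.norm_eq_abs, sq_abs, reflect, if_true]
  ring

lemma norm_reflect_sub_comm (x y : EuclideanSpace ℝ (Fin N)) :
    ‖reflect x - y‖ = ‖reflect y - x‖ := by
  rw [← sq_eq_sq₀ (norm_nonneg _) (norm_nonneg _), norm_reflect_sub_sq, norm_reflect_sub_sq,
    norm_sub_rev, mul_comm (y _)]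

lemma greenKernel_comm (x y : EuclideanSpace ℝ (Fin N)) : greenKernel x y = greenKernel y x := by
  rw [greenKernel, greenKernel, norm_reflect_sub_comm, norm_sub_rev]

lemma h_pos {t : ℝ} (ht : 0 < t) : 0 < h t := lt_min ht one_pos

lemma h_le_one (t : ℝ) : h t ≤ 1 := min_le_right _ _

lemma h_le_add (s t : ℝ) : h s ≤ h t + |s - t| := by
  have := le_abs_self (s - t)
  have := abs_nonneg (s - t)
  unfold h
  rcases le_total s 1 with h1 | h1 <;> rcases le_total t 1 with h2 | h2 <;> simp [h1, h2] <;>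
    linarith

lemma min_mul_one_le {a b : ℝ} (ha : 0 < a) (hb : 0 < b) :
    min (a * b) 1 ≤ h a * h b * (1 + |a - b|) := by
  have h1 := le_abs_self (a - b)
  have h2 := neg_abs_le (a - b)
  have h3 := abs_nonneg (a - b)
  unfold h
  rcases le_total a 1 with h4 | h4 <;> rcases le_total b 1 with h5 | h5
  · rw [min_eq_left h4, min_eq_left h5]
    refine (min_le_left _ _).trans (le_mul_of_one_le_right (by positivity) (by linarith))
  · rw [min_eq_left h4, min_eq_right h5, mul_one]
    refine (min_le_left _ _).trans (mul_le_mul_of_nonneg_left (by linarith) ha.le)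
  · rw [min_eq_right h4, min_eq_left h5, one_mul, mul_comm a]
    refine (min_le_left _ _).trans (mul_le_mul_of_nonneg_left (by linarith) hb.le)
  · rw [min_eq_right h4, min_eq_right h5]
    refine (min_le_right _ _).trans (by linarith)

lemma rpow_le_two_mul_exp_half {θ s : ℝ} (h0 : 0 ≤ θ) (h1 : θ ≤ 1) (hs : 0 < s) :
    s ^ θ ≤ 2 * Real.exp (s / 2) := by
  have h2 := Real.add_one_le_exp (s / 2)
  rcases le_total s 1 with h | h
  · have := Real.rpow_le_one hs.le h h0
    linarith
  · have := Real.rpow_le_rpow_of_exponent_le h h1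
    rw [Real.rpow_one] at this
    linarith

lemma one_sub_exp_neg_div_le {θ a s : ℝ} (h0 : 0 ≤ θ) (h1 : θ ≤ 1) (ha : 0 < a) (hs : 0 < s) :
    1 - Real.exp (-(a / s)) ≤ 2 * Real.exp (s / 2) * (min a 1 ^ θ * s ^ (-θ)) := by
  have e1 : 1 ≤ Real.exp (s / 2) := Real.one_le_exp (by positivity)
  have e2 : 0 < Real.exp (-(a / s)) := Real.exp_pos _
  rcases le_total a 1 with h | h
  · rw [min_eq_left h, Real.rpow_neg hs.le, ← div_eq_mul_inv, ← Real.div_rpow ha.le hs.le]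
    have h3 : 1 - Real.exp (-(a / s)) ≤ (a / s) ^ θ := by
      rcases le_total (a / s) 1 with h4 | h4
      · have h5 := Real.add_one_le_exp (-(a / s))
        have h6 := Real.rpow_le_rpow_of_exponent_ge (by positivity) h4 h1
        rw [Real.rpow_one] at h6
        linarith
      · have := Real.one_le_rpow h4 h0
        linarith
    have h7 : 0 ≤ (a / s) ^ θ := by positivity
    nlinarith
  · rw [min_eq_right h, Real.one_rpow, one_mul, Real.rpow_neg hs.le, ← div_eq_mul_inv,
      le_div_iff₀ (by positivity)]
    have h5 := rpow_le_two_mul_exp_half h0 h1 hs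
    have h7 : 0 ≤ s ^ θ := by positivity
    nlinarith

lemma greenKernel_eq_integral {x y : EuclideanSpace ℝ (Fin N)} (hx : x ∈ halfSpace N)
    (hy : y ∈ halfSpace N) (hxy : x ≠ y) :
    greenKernel x y = (4 * Real.pi) ^ (-(N : ℝ) / 2) * ∫ s in Set.Ioi 0,
      heatDensity ((N : ℝ) / 2) ‖x - y‖ s *
        (1 - Real.exp (-(x (lastIdx N) * y (lastIdx N) / s))) := by
  have hr : 0 < ‖x - y‖ := norm_pos_iff.2 (sub_ne_zero.2 hxy)
  have ha : 0 < x (lastIdx N) * y (lastIdx N) := mul_pos hx hy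
  have hr' : 0 < ‖reflect x - y‖ := by
    have := norm_reflect_sub_sq x y
    have : 0 < ‖reflect x - y‖ ^ 2 := by rw [this]; positivity
    exact (norm_nonneg _).lt_of_ne' fun h0 => by simp [h0] at this
  rw [greenKernel, fundSol_eq_integral_heatDensity N hr, fundSol_eq_integral_heatDensity N hr',
    ← mul_sub, ← integral_sub (integrableOn_heatDensity _ hr) (integrableOn_heatDensity _ hr')]
  congr 1
  refine setIntegral_congr_fun measurableSet_Ioi fun s hs => ?_
  have hs : 0 < s := hs
  simp only [heatDensity]
  rw [norm_reflect_sub_sq, mul_sub, mul_one, mul_assoc _ (Real.exp _), ← Real.exp_add]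
  congr 3
  field_simp
  ring

lemma half_add_sq_div_ge {r s : ℝ} (hs : 0 < s) : r / 2 ≤ s / 2 + r ^ 2 / (8 * s) := by
  rw [div_add_div _ _ two_ne_zero (by positivity), div_le_div_iff₀ two_pos (by positivity)]
  nlinarith [sq_nonneg (r - 2 * s)]

/-- Pointwise bounds of the Green kernel, one for each `θ`. -/
lemma exists_abs_greenKernel_le (N : ℕ) [NeZero N] {θ : ℝ} (h0 : 0 ≤ θ) (h1 : θ ≤ 1)
    (hθ : 0 < (N : ℝ) - 2 + 2 * θ) :
    ∃ C : ℝ, 0 < C ∧ ∀ x ∈ halfSpace N, ∀ y ∈ halfSpace N, x ≠ y →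
      |greenKernel x y| ≤ C * ((h (x (lastIdx N)) * h (y (lastIdx N))) ^ θ *
        ‖x - y‖ ^ (-((N : ℝ) - 2 + 2 * θ)) * Real.exp (-(‖x - y‖ / 4))) := by
  set p : ℝ := (N : ℝ) / 2 + θ - 1 with hp
  have hp0 : 0 < p := by rw [hp]; linarith
  set I : ℝ := ∫ s in Set.Ioi (0 : ℝ), s ^ (-1 - p) * Real.exp (-(1 / 8 / s)) with hI
  have hI0 : 0 ≤ I := setIntegral_nonneg measurableSet_Ioi fun s hs => by
    have hs : 0 < s := hs
    positivity
  set c : ℝ := (4 * Real.pi) ^ (-(N : ℝ) / 2) with hc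
  have hc0 : 0 < c := by positivity
  refine ⟨c * 8 * (I + 1), by positivity, fun x hx y hy hxy => ?_⟩
  set r := ‖x - y‖ with hr
  set a := x (lastIdx N) * y (lastIdx N) with ha
  have hr0 : 0 < r := norm_pos_iff.2 (sub_ne_zero.2 hxy)
  have ha0 : 0 < a := mul_pos hx hy
  set M := min a 1 ^ θ with hM
  have hM0 : 0 ≤ M := by positivity
  have hint : IntegrableOn (fun s : ℝ => s ^ (-1 - p) * Real.exp (-(r ^ 2 / 8 / s)))
      (Set.Ioi 0) := integrableOn_rpow_mul_exp_neg_div hp0 (by positivity)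
  have hscale : ∫ s in Set.Ioi (0 : ℝ), s ^ (-1 - p) * Real.exp (-(r ^ 2 / 8 / s)) =
      r ^ (-(2 * p)) * I := by
    have h2 := integral_comp_mul_left_Ioi
      (fun s : ℝ => s ^ (-1 - p) * Real.exp (-(r ^ 2 / 8 / s))) 0 (b := r ^ 2) (by positivity)
    rw [mul_zero] at h2
    have h3 : ∫ s in Set.Ioi (0 : ℝ), (r ^ 2 * s) ^ (-1 - p) * Real.exp (-(r ^ 2 / 8 / (r ^ 2 * s)))
        = (r ^ 2) ^ (-1 - p) * I := by
      rw [hI, ← integral_const_mul]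
      refine setIntegral_congr_fun measurableSet_Ioi fun s hs => ?_
      have hs : 0 < s := hs
      rw [Real.mul_rpow (by positivity) hs.le, mul_assoc]
      congr 4
      field_simp
    rw [h3, smul_eq_mul, eq_inv_mul_iff_mul_eq₀ (by positivity)] at h2
    rw [← h2, ← mul_assoc]
    congr 1
    rw [← Real.rpow_natCast r 2, ← Real.rpow_mul hr0.le, ← Real.rpow_add hr0]
    congr 1
    push_cast; ring
  have hpt : ∀ s ∈ Set.Ioi (0 : ℝ),
      ‖heatDensity ((N : ℝ) / 2) r s * (1 - Real.exp (-(a / s)))‖ ≤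
        2 * M * Real.exp (-(r / 2)) * (s ^ (-1 - p) * Real.exp (-(r ^ 2 / 8 / s))) := by
    intro s hs
    have hs : 0 < s := hs
    have h2 := one_sub_exp_neg_div_le h0 h1 ha0 hs
    have h3 : 0 ≤ 1 - Real.exp (-(a / s)) := by
      rw [sub_nonneg, Real.exp_le_one_iff]
      have : 0 < a / s := by positivity
      linarith
    rw [Real.norm_of_nonneg (mul_nonneg (heatDensity_nonneg hs) h3)]
    refine (mul_le_mul_of_nonneg_left h2 (heatDensity_nonneg hs)).trans ?_
    have h4 : s ^ (-1 - p) = s ^ (-((N : ℝ) / 2)) * s ^ (-θ) := by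
      rw [← Real.rpow_add hs]; congr 1; rw [hp]; ring
    have h5 : Real.exp (-(s + r ^ 2 / (4 * s))) * Real.exp (s / 2) ≤
        Real.exp (-(r / 2)) * Real.exp (-(r ^ 2 / 8 / s)) := by
      rw [← Real.exp_add, ← Real.exp_add, Real.exp_le_exp]
      have := half_add_sq_div_ge (r := r) hs
      have e1 : r ^ 2 / (4 * s) = 2 * (r ^ 2 / (8 * s)) := by field_simp; ring
      have e2 : r ^ 2 / 8 / s = r ^ 2 / (8 * s) := by field_simp
      rw [e1, e2]
      linarith
    rw [heatDensity, h4]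
    calc _ = 2 * M * (s ^ (-((N : ℝ) / 2)) * s ^ (-θ)) *
          (Real.exp (-(s + r ^ 2 / (4 * s))) * Real.exp (s / 2)) := by ring
      _ ≤ 2 * M * (s ^ (-((N : ℝ) / 2)) * s ^ (-θ)) *
          (Real.exp (-(r / 2)) * Real.exp (-(r ^ 2 / 8 / s))) := by gcongr
      _ = _ := by ring
  have hG : |greenKernel x y| ≤ c * (2 * M * Real.exp (-(r / 2)) * (r ^ (-(2 * p)) * I)) := by
    rw [greenKernel_eq_integral hx hy hxy, abs_mul, abs_of_pos hc0]
    refine mul_le_mul_of_nonneg_left ?_ hc0.le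
    rw [← hscale, ← integral_const_mul]
    exact norm_integral_le_of_norm_le (hint.const_mul _)
      ((ae_restrict_iff' measurableSet_Ioi).2 (Filter.Eventually.of_forall hpt))
  refine hG.trans ?_
  have hhx := h_pos hx
  have hhy := h_pos hy
  have hdist : |x (lastIdx N) - y (lastIdx N)| ≤ r := by
    have := PiLp.norm_apply_le (x - y) (lastIdx N)
    simpa using this
  have hM1 : M ≤ (h (x (lastIdx N)) * h (y (lastIdx N))) ^ θ * (1 + r) := by
    have h2 : min a 1 ≤ h (x (lastIdx N)) * h (y (lastIdx N)) * (1 + r) :=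
      (min_mul_one_le hx hy).trans (by gcongr)
    refine (Real.rpow_le_rpow (by positivity) h2 h0).trans ?_
    rw [Real.mul_rpow (by positivity) (by positivity)]
    gcongr
    exact (Real.rpow_le_rpow_of_exponent_le (by linarith) h1).trans_eq (Real.rpow_one _)
  have h4 : (1 + r) * Real.exp (-(r / 2)) ≤ 4 * Real.exp (-(r / 4)) := by
    have h5 := Real.add_one_le_exp (r / 4)
    have h6 : Real.exp (-(r / 4)) = Real.exp (r / 4) * Real.exp (-(r / 2)) := by
      rw [← Real.exp_add]; congr 1; ring
    rw [h6, ← mul_assoc]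
    gcongr
    linarith
  have h7 : -(2 * p) = -((N : ℝ) - 2 + 2 * θ) := by rw [hp]; ring
  rw [h7]
  set H := (h (x (lastIdx N)) * h (y (lastIdx N))) ^ θ
  set R := r ^ (-((N : ℝ) - 2 + 2 * θ))
  have hH : 0 ≤ H := by positivity
  have hR : 0 ≤ R := by positivity
  calc c * (2 * M * Real.exp (-(r / 2)) * (R * I))
      ≤ c * (2 * (H * (1 + r)) * Real.exp (-(r / 2)) * (R * I)) := by gcongr
    _ = 2 * c * H * R * I * ((1 + r) * Real.exp (-(r / 2))) := by ring
    _ ≤ 2 * c * H * R * (I + 1) * (4 * Real.exp (-(r / 4))) := by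
        gcongr
        linarith
    _ = _ := by ring

end HalfSpaceGreen

namespace HalfSpaceGreen

lemma rpow_le_two_rpow_abs_mul {a b : ℝ} (hb : 0 < b) (h1 : b / 2 ≤ a) (h2 : a ≤ 2 * b) (σ : ℝ) :
    a ^ σ ≤ 2 ^ |σ| * b ^ σ := by
  have ha : 0 < a := by linarith
  rcases le_total 0 σ with hσ | hσ
  · rw [abs_of_nonneg hσ, ← Real.mul_rpow two_pos.le hb.le]
    exact Real.rpow_le_rpow ha.le h2 hσ
  · have h3 : (2 : ℝ) ^ (-σ) * b ^ σ = (b / 2) ^ σ := by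
      rw [Real.div_rpow hb.le two_pos.le, Real.rpow_neg two_pos.le]; field_simp
    rw [abs_of_nonpos hσ, h3]
    exact Real.rpow_le_rpow_of_nonpos (by linarith) h1 hσ

lemma integrable_one_add_abs_rpow_mul_abs_rpow {κ ε : ℝ} (hκ : -1 < κ) (hε : 0 < ε) :
    Integrable (fun w : ℝ => (1 + |w|) ^ (-(1 + ε + κ)) * |w| ^ κ) := by
  have key : IntegrableOn (fun w : ℝ => (1 + w) ^ (-(1 + ε + κ)) * w ^ κ) (Set.Ioi 0) := by
    have hmeas : Measurable (fun w : ℝ => (1 + w) ^ (-(1 + ε + κ)) * w ^ κ) := by fun_prop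
    rw [← Set.Ioc_union_Ioi_eq_Ioi zero_le_one]
    refine IntegrableOn.union ?_ ?_
    · have h1 : IntegrableOn (fun w : ℝ => w ^ κ) (Set.Ioc 0 1) :=
        (intervalIntegrable_iff_integrableOn_Ioc_of_le zero_le_one).1
          (intervalIntegral.intervalIntegrable_rpow' hκ)
      refine Integrable.mono' h1 hmeas.aestronglyMeasurable
        ((ae_restrict_iff' measurableSet_Ioc).2 (Filter.Eventually.of_forall fun w hw => ?_))
      have hw0 : 0 < w := hw.1
      rw [Real.norm_of_nonneg (by positivity)]
      exact mul_le_of_le_one_left (by positivity)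
        (Real.rpow_le_one_of_one_le_of_nonpos (by linarith) (by linarith))
    · have h1 : IntegrableOn (fun w : ℝ => w ^ (-1 - ε)) (Set.Ioi 1) :=
        integrableOn_Ioi_rpow_of_lt (by linarith) one_pos
      refine Integrable.mono' h1 hmeas.aestronglyMeasurable
        ((ae_restrict_iff' measurableSet_Ioi).2 (Filter.Eventually.of_forall fun w hw => ?_))
      have hw1 : 1 < w := hw
      have hw0 : 0 < w := by linarith
      rw [Real.norm_of_nonneg (by positivity),
        show -1 - ε = -(1 + ε + κ) + κ by ring, Real.rpow_add hw0]
      refine mul_le_mul_of_nonneg_right ?_ (by positivity)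
      exact Real.rpow_le_rpow_of_nonpos hw0 (by linarith) (by linarith)
  have := (integrable_fun_norm_addHaar (E := ℝ) volume
    (f := fun w : ℝ => (1 + w) ^ (-(1 + ε + κ)) * w ^ κ)).2 (by simpa using key)
  simpa [Real.norm_eq_abs] using this

variable {N : ℕ}

/-- The truncated Riesz kernel. -/
noncomputable def nearProfile (N : ℕ) (a : ℝ) (z : EuclideanSpace ℝ (Fin N)) : ℝ :=
  if ‖z‖ ≤ 1 / 2 then ‖z‖ ^ (-a) else 0

/-- The Japanese bracket `(1 + |z|)^{-(N + ε)}`. -/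
noncomputable def farProfile (N : ℕ) (ε : ℝ) (z : EuclideanSpace ℝ (Fin N)) : ℝ :=
  (1 + ‖z‖) ^ (-((N : ℝ) + ε))

/-- The exponent concentrated in the last coordinate. -/
noncomputable def lastExp {N : ℕ} [NeZero N] (κ : ℝ) (i : Fin N) : ℝ :=
  if i = lastIdx N then κ else 0

/-- A product profile with the singular weight `|z_N|^κ` in the last coordinate. -/
noncomputable def boundaryProfile (N : ℕ) [NeZero N] (κ ε : ℝ)
    (z : EuclideanSpace ℝ (Fin N)) : ℝ :=
  ∏ i, ((1 + |z i|) ^ (-(1 + ε + lastExp κ i)) * |z i| ^ lastExp κ i)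

lemma nearProfile_nonneg (a : ℝ) (z : EuclideanSpace ℝ (Fin N)) : 0 ≤ nearProfile N a z := by
  unfold nearProfile; split_ifs <;> positivity

lemma farProfile_nonneg (ε : ℝ) (z : EuclideanSpace ℝ (Fin N)) : 0 ≤ farProfile N ε z := by
  unfold farProfile; positivity

lemma boundaryProfile_nonneg [NeZero N] (κ ε : ℝ) (z : EuclideanSpace ℝ (Fin N)) :
    0 ≤ boundaryProfile N κ ε z := by
  unfold boundaryProfile; positivity

lemma integrable_nearProfile [NeZero N] {a : ℝ} (ha : a < N) : Integrable (nearProfile N a) := by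
  have hN : 1 ≤ N := NeZero.one_le
  have h1 : IntegrableOn (fun w : ℝ => w ^ ((N : ℝ) - 1 - a)) (Set.Ioc 0 (1 / 2)) :=
    (intervalIntegrable_iff_integrableOn_Ioc_of_le (by norm_num)).1
      (intervalIntegral.intervalIntegrable_rpow' (by linarith))
  refine (integrable_fun_norm_addHaar (E := EuclideanSpace ℝ (Fin N)) volume
    (f := fun w : ℝ => if w ≤ 1 / 2 then w ^ (-a) else 0)).2 ?_
  rw [finrank_euclideanSpace_fin, ← Set.Ioc_union_Ioi_eq_Ioi (show (0 : ℝ) ≤ 1 / 2 by norm_num)]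
  refine IntegrableOn.union (h1.congr_fun (fun w hw => ?_) measurableSet_Ioc)
    (integrableOn_zero.congr_fun (fun w hw => ?_) measurableSet_Ioi)
  · have hw0 : 0 < w := hw.1
    simp only [if_pos hw.2, smul_eq_mul]
    rw [← Real.rpow_natCast, ← Real.rpow_add hw0, Nat.cast_sub hN]
    congr 1
    push_cast; ring
  · have hw : 1 / 2 < w := hw
    simp only [if_neg (not_le.2 hw), smul_zero]

lemma integrable_farProfile {ε : ℝ} (hε : 0 < ε) : Integrable (farProfile N ε) :=
  integrable_one_add_norm (by rw [finrank_euclideanSpace_fin]; linarith)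

lemma integrable_boundaryProfile [NeZero N] {κ ε : ℝ} (hκ : -1 < κ) (hε : 0 < ε) :
    Integrable (boundaryProfile N κ ε) := by
  have h1 : Integrable (fun z : Fin N → ℝ =>
      ∏ i, ((1 + |z i|) ^ (-(1 + ε + lastExp κ i)) * |z i| ^ lastExp κ i)) := by
    refine Integrable.fintype_prod (μ := fun _ => volume) (f := fun i (w : ℝ) =>
      (1 + |w|) ^ (-(1 + ε + lastExp κ i)) * |w| ^ lastExp κ i) fun i => ?_
    refine integrable_one_add_abs_rpow_mul_abs_rpow ?_ hε
    unfold lastExp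
    split_ifs
    · exact hκ
    · norm_num
  exact (EuclideanSpace.volume_preserving_symm_measurableEquiv_toLp (Fin N)).integrable_comp_of_integrable h1

lemma lintegral_ofReal_comp_scale {Φ : EuclideanSpace ℝ (Fin N) → ℝ} (hΦ : Integrable Φ)
    (h0 : ∀ z, 0 ≤ Φ z) {ρ : ℝ} (hρ : 0 < ρ) (a : EuclideanSpace ℝ (Fin N)) :
    ∫⁻ y, ENNReal.ofReal (Φ (ρ⁻¹ • (y - a))) = ENNReal.ofReal (ρ ^ (N : ℝ) * ∫ z, Φ z) := by
  have h1 : Integrable (fun y => Φ (ρ⁻¹ • y)) := hΦ.comp_smul (by positivity)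
  rw [← ofReal_integral_eq_lintegral_ofReal (h1.comp_sub_right a)
    (Filter.Eventually.of_forall fun y => h0 _),
    integral_sub_right_eq_self (fun y => Φ (ρ⁻¹ • y)) a, Measure.integral_comp_smul,
    finrank_euclideanSpace_fin, Real.rpow_natCast, smul_eq_mul, abs_of_pos (by positivity)]
  simp

/-- The orthogonal projection on the boundary hyperplane. -/
noncomputable def boundaryProj [NeZero N] (x : EuclideanSpace ℝ (Fin N)) : EuclideanSpace ℝ (Fin N) :=
  WithLp.toLp 2 (fun i => if i = lastIdx N then 0 else x i)

lemma abs_apply_sub_le (x y : EuclideanSpace ℝ (Fin N)) (i : Fin N) : |x i - y i| ≤ ‖x - y‖ := by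
  simpa using PiLp.norm_apply_le (x - y) i

lemma exists_far_bound (N : ℕ) [NeZero N] {κ ε δ : ℝ} (hκ : -1 < κ) (hε : 0 < ε) (hδ : 0 < δ) :
    ∃ C : ℝ, 0 < C ∧ ∀ x ∈ halfSpace N, ∀ y ∈ halfSpace N, h (x (lastIdx N)) / 2 ≤ ‖x - y‖ →
      ‖x - y‖ ^ (-((N : ℝ) + κ + ε)) * Real.exp (-(δ * ‖x - y‖)) * h (y (lastIdx N)) ^ κ ≤
        C * (h (x (lastIdx N)) ^ (-((N : ℝ) + ε)) *
          (farProfile N ε ((h (x (lastIdx N)))⁻¹ • (y - x)) +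
            boundaryProfile N κ (ε / N) ((h (x (lastIdx N)))⁻¹ • (y - boundaryProj x)))) := by
  obtain ⟨C₁, hC₁, hb⟩ := exists_rpow_mul_exp_neg_le (abs_nonneg κ) hδ
  have hN : (1 : ℝ) ≤ N := by exact_mod_cast NeZero.one_le (n := N)
  set c : ℝ := 3 ^ ((N : ℝ) + ε) with hc
  have hc0 : 0 < c := by positivity
  refine ⟨(3 ^ |κ| + 1 + C₁) * c + 3 ^ ((N : ℝ) + κ + ε), by positivity,
    fun x hx y hy hr => ?_⟩
  set ρ := h (x (lastIdx N)) with hρ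
  set r := ‖x - y‖ with hrdef
  have hρ0 : 0 < ρ := h_pos hx
  have hhy : 0 < h (y (lastIdx N)) := h_pos hy
  have hr0 : 0 < r := by linarith
  set Z := ρ⁻¹ • (y - x) with hZ
  set W := ρ⁻¹ • (y - boundaryProj x) with hW
  have hZn : ‖Z‖ = r / ρ := by
    rw [hZ, norm_smul, norm_inv, Real.norm_of_nonneg hρ0.le, norm_sub_rev, inv_mul_eq_div]
  have hR : 1 / 2 ≤ r / ρ := by rw [le_div_iff₀ hρ0]; linarith
  have hfar : r ^ (-((N : ℝ) + ε)) ≤ c * (ρ ^ (-((N : ℝ) + ε)) * farProfile N ε Z) := by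
    have h1 : (r / ρ) ^ (-((N : ℝ) + ε)) ≤ c * farProfile N ε Z := by
      have h2 : (3 * (r / ρ)) ^ (-((N : ℝ) + ε)) ≤ farProfile N ε Z := by
        unfold farProfile
        rw [hZn]
        exact Real.rpow_le_rpow_of_nonpos (by linarith) (by linarith) (by linarith)
      rw [Real.mul_rpow (by norm_num) (by positivity), Real.rpow_neg (by norm_num), ← hc,
        inv_mul_le_iff₀ hc0] at h2
      exact h2
    rw [Real.div_rpow hr0.le hρ0.le, div_le_iff₀ (by positivity)] at h1
    linarith
  have hF := farProfile_nonneg ε Z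
  have hB := boundaryProfile_nonneg κ (ε / N) W
  have hP : 0 ≤ ρ ^ (-((N : ℝ) + ε)) := by positivity
  have hexp : Real.exp (-(δ * r)) ≤ 1 := Real.exp_le_one_iff.2 (by nlinarith)
  have hsplit : r ^ (-((N : ℝ) + κ + ε)) = r ^ (-((N : ℝ) + ε)) * r ^ (-κ) := by
    rw [← Real.rpow_add hr0]; congr 1; ring
  have hκr : r ^ (-κ) * r ^ κ = 1 := by
    rw [← Real.rpow_add hr0]; simp
  have hyx : h (y (lastIdx N)) ≤ ρ + r :=
    (h_le_add _ (x (lastIdx N))).trans (by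
      have := abs_apply_sub_le x y (lastIdx N)
      rw [abs_sub_comm] at this
      linarith)
  have hfarcase : ∀ D : ℝ, 0 ≤ D → D ≤ 3 ^ |κ| + 1 + C₁ →
      r ^ (-κ) * Real.exp (-(δ * r)) * h (y (lastIdx N)) ^ κ ≤ D →
      r ^ (-((N : ℝ) + κ + ε)) * Real.exp (-(δ * r)) * h (y (lastIdx N)) ^ κ ≤
        ((3 ^ |κ| + 1 + C₁) * c + 3 ^ ((N : ℝ) + κ + ε)) * (ρ ^ (-((N : ℝ) + ε)) *
          (farProfile N ε Z + boundaryProfile N κ (ε / N) W)) := by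
    intro D hD0 hD hle
    calc _ = r ^ (-((N : ℝ) + ε)) *
          (r ^ (-κ) * Real.exp (-(δ * r)) * h (y (lastIdx N)) ^ κ) := by rw [hsplit]; ring
      _ ≤ c * (ρ ^ (-((N : ℝ) + ε)) * farProfile N ε Z) * (3 ^ |κ| + 1 + C₁) := by
          gcongr
          exact hle.trans hD
      _ = ((3 ^ |κ| + 1 + C₁) * c + 0) * (ρ ^ (-((N : ℝ) + ε)) * (farProfile N ε Z + 0)) := by ring
      _ ≤ _ := by gcongr; positivity
  have h3κ : 0 < (3 : ℝ) ^ |κ| := by positivity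
  rcases le_or_gt 0 κ with hκ0 | hκ0
  · refine hfarcase (3 ^ |κ|) h3κ.le (by linarith) ?_
    have h1 : h (y (lastIdx N)) ^ κ ≤ 3 ^ |κ| * r ^ κ := by
      rw [abs_of_nonneg hκ0, ← Real.mul_rpow (by norm_num) hr0.le]
      exact Real.rpow_le_rpow hhy.le (by linarith) hκ0
    calc _ ≤ r ^ (-κ) * 1 * (3 ^ |κ| * r ^ κ) := by gcongr
      _ = 3 ^ |κ| * (r ^ (-κ) * r ^ κ) := by ring
      _ = _ := by rw [hκr, mul_one]
  rcases le_or_gt r (h (y (lastIdx N))) with h1 | h1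
  · refine hfarcase 1 zero_le_one (by linarith) ?_
    have h2 : h (y (lastIdx N)) ^ κ ≤ r ^ κ := Real.rpow_le_rpow_of_nonpos hr0 h1 hκ0.le
    calc _ ≤ r ^ (-κ) * 1 * r ^ κ := by gcongr
      _ = _ := by rw [mul_one, hκr]
  rcases le_or_gt 1 (y (lastIdx N)) with h2 | h2
  · refine hfarcase C₁ hC₁.le (by linarith) ?_
    have h3 : h (y (lastIdx N)) = 1 := min_eq_right h2
    rw [h3, Real.one_rpow, mul_one, ← abs_of_neg hκ0]
    exact hb r hr0
  have h3 : h (y (lastIdx N)) = y (lastIdx N) := min_eq_left h2.le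
  rw [h3] at h1 ⊢
  set s := y (lastIdx N) with hs
  have hs0 : 0 < s := hy
  have hR0 : 0 < r / ρ := by positivity
  have hWle : ∀ i, 1 + |W i| ≤ 3 * (r / ρ) := by
    intro i
    have : |W i| ≤ r / ρ := by
      simp only [hW, boundaryProj, PiLp.smul_apply, PiLp.sub_apply, smul_eq_mul, inv_mul_eq_div,
        abs_div, abs_of_pos hρ0]
      refine div_le_div_of_nonneg_right ?_ hρ0.le
      split_ifs with hi
      · rw [sub_zero, hi, ← hs, abs_of_pos hs0]; exact h1.le
      · rw [abs_sub_comm]; exact abs_apply_sub_le x y i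
    linarith
  have hsum : ∑ i : Fin N, (-(1 + ε / N + lastExp κ i)) = -((N : ℝ) + κ + ε) := by
    simp only [lastExp, Finset.sum_neg_distrib, Finset.sum_add_distrib, Finset.sum_const,
      Finset.card_univ, Fintype.card_fin, nsmul_eq_mul, Finset.sum_ite_eq', Finset.mem_univ, if_true]
    field_simp
    ring
  have hWlast : |W (lastIdx N)| = s / ρ := by
    simp only [hW, boundaryProj, PiLp.smul_apply, PiLp.sub_apply, smul_eq_mul, inv_mul_eq_div,
      if_true, sub_zero]
    rw [← hs, abs_of_pos (by positivity)]
  have hprod : ∏ i, |W i| ^ lastExp κ i = (s / ρ) ^ κ := by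
    rw [Finset.prod_eq_single (lastIdx N) (fun i _ hi => by simp [lastExp, hi]) (by simp), hWlast,
      lastExp, if_pos rfl]
  have hbd : (3 * (r / ρ)) ^ (-((N : ℝ) + κ + ε)) * (s / ρ) ^ κ ≤ boundaryProfile N κ (ε / N) W := by
    rw [← hsum, Real.rpow_sum_of_pos (by positivity), ← hprod, ← Finset.prod_mul_distrib]
    unfold boundaryProfile
    refine Finset.prod_le_prod (fun i _ => by positivity) fun i _ => ?_
    refine mul_le_mul_of_nonneg_right ?_ (by positivity)
    refine Real.rpow_le_rpow_of_nonpos (by positivity) (hWle i) ?_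
    have : 0 < ε / N := by positivity
    unfold lastExp
    split_ifs <;> linarith
  have hident : r ^ (-((N : ℝ) + κ + ε)) * s ^ κ = 3 ^ ((N : ℝ) + κ + ε) * (ρ ^ (-((N : ℝ) + ε)) *
      ((3 * (r / ρ)) ^ (-((N : ℝ) + κ + ε)) * (s / ρ) ^ κ)) := by
    rw [Real.mul_rpow (by norm_num) (by positivity), Real.div_rpow hr0.le hρ0.le,
      Real.div_rpow hs0.le hρ0.le, Real.rpow_neg (by norm_num : (0 : ℝ) ≤ 3)]
    have : ρ ^ (-((N : ℝ) + ε)) = ρ ^ (-((N : ℝ) + κ + ε)) * ρ ^ κ := by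
      rw [← Real.rpow_add hρ0]; congr 1; ring
    rw [this]
    field_simp
  calc _ ≤ r ^ (-((N : ℝ) + κ + ε)) * 1 * s ^ κ := by gcongr
    _ = 3 ^ ((N : ℝ) + κ + ε) * (ρ ^ (-((N : ℝ) + ε)) *
      ((3 * (r / ρ)) ^ (-((N : ℝ) + κ + ε)) * (s / ρ) ^ κ)) := by rw [mul_one, hident]
    _ ≤ (0 + 3 ^ ((N : ℝ) + κ + ε)) * (ρ ^ (-((N : ℝ) + ε)) *
        (0 + boundaryProfile N κ (ε / N) W)) := by rw [zero_add, zero_add]; gcongr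
    _ ≤ _ := by gcongr; positivity

end HalfSpaceGreen

namespace HalfSpaceGreen

lemma exists_near_bound (N : ℕ) [NeZero N] {m σ θ : ℝ} (hm : 1 ≤ m) (h0 : 0 ≤ θ) (h1 : θ ≤ 1)
    (hθ : 0 < (N : ℝ) - 2 + 2 * θ) :
    ∃ C : ℝ, 0 < C ∧ ∀ x ∈ halfSpace N, ∀ y ∈ halfSpace N, x ≠ y →
      ‖x - y‖ ≤ h (x (lastIdx N)) / 2 →
      |greenKernel x y| ^ m * h (y (lastIdx N)) ^ σ ≤
        C * (h (x (lastIdx N)) ^ ((2 - (N : ℝ)) * m + σ) *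
          nearProfile N (((N : ℝ) - 2 + 2 * θ) * m) ((h (x (lastIdx N)))⁻¹ • (y - x))) := by
  obtain ⟨C, hC, hb⟩ := exists_abs_greenKernel_le N h0 h1 hθ
  refine ⟨(C * 2 ^ θ) ^ m * 2 ^ |σ|, by positivity, fun x hx y hy hxy hr => ?_⟩
  have hG := hb x hx y hy hxy
  set ρ := h (x (lastIdx N)) with hρ
  set η := h (y (lastIdx N)) with hη
  set r := ‖x - y‖ with hrdef
  set l := (N : ℝ) - 2 + 2 * θ with hl
  have hρ0 : 0 < ρ := h_pos hx
  have hη0 : 0 < η := h_pos hy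
  have hr0 : 0 < r := norm_pos_iff.2 (sub_ne_zero.2 hxy)
  have hd := abs_apply_sub_le x y (lastIdx N)
  have hη1 : ρ / 2 ≤ η := by
    have := h_le_add (x (lastIdx N)) (y (lastIdx N))
    linarith
  have hη2 : η ≤ 2 * ρ := by
    have := h_le_add (y (lastIdx N)) (x (lastIdx N))
    rw [abs_sub_comm] at this
    linarith
  have hZ : nearProfile N (l * m) (ρ⁻¹ • (y - x)) = (r / ρ) ^ (-(l * m)) := by
    have hn : ‖ρ⁻¹ • (y - x)‖ = r / ρ := by
      rw [norm_smul, norm_inv, Real.norm_of_nonneg hρ0.le, norm_sub_rev, inv_mul_eq_div]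
    rw [nearProfile, hn, if_pos]
    rw [div_le_iff₀ hρ0]; linarith
  have hG2 : |greenKernel x y| ≤ C * 2 ^ θ * (ρ ^ (2 * θ) * r ^ (-l)) := by
    have h2 : (ρ * η) ^ θ ≤ 2 ^ θ * ρ ^ (2 * θ) := by
      rw [Real.rpow_mul hρ0.le, ← Real.mul_rpow two_pos.le (by positivity)]
      refine Real.rpow_le_rpow (by positivity) ?_ h0
      rw [Real.rpow_two]
      nlinarith
    have h3 : Real.exp (-(r / 4)) ≤ 1 := Real.exp_le_one_iff.2 (by linarith)
    calc _ ≤ C * ((ρ * η) ^ θ * r ^ (-l) * Real.exp (-(r / 4))) := hG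
      _ ≤ C * (2 ^ θ * ρ ^ (2 * θ) * r ^ (-l) * 1) := by gcongr
      _ = _ := by ring
  have hm0 : 0 ≤ m := by linarith
  have hGm : |greenKernel x y| ^ m ≤ (C * 2 ^ θ) ^ m * (ρ ^ (2 * θ * m) * r ^ (-(l * m))) := by
    refine (Real.rpow_le_rpow (abs_nonneg _) hG2 hm0).trans_eq ?_
    rw [Real.mul_rpow (x := C * 2 ^ θ) (by positivity) (by positivity),
      Real.mul_rpow (x := ρ ^ (2 * θ)) (by positivity) (by positivity),
      ← Real.rpow_mul hρ0.le, ← Real.rpow_mul hr0.le, neg_mul]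
  have hηs := rpow_le_two_rpow_abs_mul hρ0 hη1 hη2 σ
  rw [hZ, Real.div_rpow hr0.le hρ0.le]
  have hρe : ρ ^ (2 * θ * m) * ρ ^ σ = ρ ^ ((2 - (N : ℝ)) * m + σ) / ρ ^ (-(l * m)) := by
    rw [← Real.rpow_add hρ0, ← Real.rpow_sub hρ0]; congr 1; rw [hl]; ring
  calc _ ≤ (C * 2 ^ θ) ^ m * (ρ ^ (2 * θ * m) * r ^ (-(l * m))) * (2 ^ |σ| * ρ ^ σ) := by gcongr
    _ = (C * 2 ^ θ) ^ m * 2 ^ |σ| * (ρ ^ (2 * θ * m) * ρ ^ σ * r ^ (-(l * m))) := by ring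
    _ = _ := by rw [hρe]; ring

lemma exists_far_kernel_bound (N : ℕ) [NeZero N] {m σ τ : ℝ} (hm : 1 ≤ m) (hσ : -1 - m < σ)
    (hτ : τ < m) (hτ' : τ ≤ (2 - (N : ℝ)) * m + N + σ) :
    ∃ C : ℝ, 0 < C ∧ ∀ x ∈ halfSpace N, ∀ y ∈ halfSpace N, x ≠ y →
      h (x (lastIdx N)) / 2 ≤ ‖x - y‖ →
      |greenKernel x y| ^ m * h (y (lastIdx N)) ^ σ ≤
        C * (h (x (lastIdx N)) ^ (τ - N) *
          (farProfile N ((m - τ) / 2) ((h (x (lastIdx N)))⁻¹ • (y - x)) +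
            boundaryProfile N (m + σ) ((m - τ) / 2 / N)
              ((h (x (lastIdx N)))⁻¹ • (y - boundaryProj x)))) := by
  have hN : (1 : ℝ) ≤ N := by exact_mod_cast NeZero.one_le (n := N)
  have hm0 : 0 < m := by linarith
  set ε := (m - τ) / 2 with hε
  have hε0 : 0 < ε := by rw [hε]; linarith
  obtain ⟨C₁, hC₁, hb⟩ := exists_abs_greenKernel_le N zero_le_one le_rfl (by linarith)
  obtain ⟨C₂, hC₂, hfar⟩ := exists_far_bound N (κ := m + σ) (ε := ε) (δ := m / 8) (by linarith)
    hε0 (by positivity)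
  obtain ⟨C₃, hC₃, hexp⟩ := exists_rpow_mul_exp_neg_le
    (k := (2 - (N : ℝ)) * m + N + σ - τ) (δ := m / 8) (by linarith) (by positivity)
  refine ⟨C₁ ^ m * C₃ * 2 ^ ε * C₂, by positivity, fun x hx y hy hxy hr => ?_⟩
  have hG := hb x hx y hy hxy
  have hF := hfar x hx y hy hr
  set ρ := h (x (lastIdx N)) with hρ
  set η := h (y (lastIdx N)) with hη
  set r := ‖x - y‖ with hrdef
  have hρ0 : 0 < ρ := h_pos hx
  have hη0 : 0 < η := h_pos hy
  have hr0 : 0 < r := norm_pos_iff.2 (sub_ne_zero.2 hxy)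
  have hE := hexp r hr0
  rw [mul_one, Real.rpow_one, sub_add_cancel] at hG
  have hGm : |greenKernel x y| ^ m ≤
      C₁ ^ m * (ρ ^ m * η ^ m * r ^ (-(N * m)) * Real.exp (-(m / 4 * r))) := by
    refine (Real.rpow_le_rpow (abs_nonneg _) hG hm0.le).trans_eq ?_
    rw [Real.mul_rpow (by positivity) (by positivity), Real.mul_rpow (by positivity) (by positivity),
      Real.mul_rpow (by positivity) (by positivity), Real.mul_rpow (by positivity) (by positivity),
      ← Real.rpow_mul hr0.le, ← Real.exp_mul, neg_mul]
    congr 3; ring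
  have hrε : r ^ (-ε) ≤ 2 ^ ε * ρ ^ (-ε) := by
    have h1 : (2 : ℝ) ^ ε * ρ ^ (-ε) = (ρ / 2) ^ (-ε) := by
      rw [Real.div_rpow hρ0.le two_pos.le, Real.rpow_neg two_pos.le]; field_simp
    rw [h1]
    exact Real.rpow_le_rpow_of_nonpos (by positivity) hr (by linarith)
  have hrs : r ^ (-(N * m)) = r ^ (-((N : ℝ) + (m + σ) + ε)) *
      r ^ ((2 - (N : ℝ)) * m + N + σ - τ) * r ^ (-ε) := by
    rw [← Real.rpow_add hr0, ← Real.rpow_add hr0]; congr 1; rw [hε]; ring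
  have hes : Real.exp (-(m / 4 * r)) = Real.exp (-(m / 8 * r)) * Real.exp (-(m / 8 * r)) := by
    rw [← Real.exp_add]; congr 1; ring
  have hηm : η ^ (m + σ) = η ^ m * η ^ σ := Real.rpow_add hη0 _ _
  have hρe : ρ ^ m * ρ ^ (-ε) * ρ ^ (-((N : ℝ) + ε)) = ρ ^ (τ - N) := by
    rw [← Real.rpow_add hρ0, ← Real.rpow_add hρ0]; congr 1; rw [hε]; ring
  have hFar0 := farProfile_nonneg ε (ρ⁻¹ • (y - x))
  have hB0 := boundaryProfile_nonneg (m + σ) (ε / N) (ρ⁻¹ • (y - boundaryProj x))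
  calc _ ≤ C₁ ^ m * (ρ ^ m * η ^ m * r ^ (-(N * m)) * Real.exp (-(m / 4 * r))) * η ^ σ := by gcongr
    _ = C₁ ^ m * ρ ^ m *
        (r ^ (-((N : ℝ) + (m + σ) + ε)) * Real.exp (-(m / 8 * r)) * η ^ (m + σ)) *
        (r ^ ((2 - (N : ℝ)) * m + N + σ - τ) * Real.exp (-(m / 8 * r))) * r ^ (-ε) := by
      rw [hrs, hes, hηm]; ring
    _ ≤ C₁ ^ m * ρ ^ m * (C₂ * (ρ ^ (-((N : ℝ) + ε)) * (farProfile N ε (ρ⁻¹ • (y - x)) +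
          boundaryProfile N (m + σ) (ε / N) (ρ⁻¹ • (y - boundaryProj x))))) * C₃ *
        (2 ^ ε * ρ ^ (-ε)) := by gcongr
    _ = C₁ ^ m * C₃ * 2 ^ ε * C₂ * (ρ ^ m * ρ ^ (-ε) * ρ ^ (-((N : ℝ) + ε)) *
          (farProfile N ε (ρ⁻¹ • (y - x)) +
          boundaryProfile N (m + σ) (ε / N) (ρ⁻¹ • (y - boundaryProj x)))) := by ring
    _ = _ := by rw [hρe]

/-- Weighted `L^m` bound for the Green kernel in one variable. -/
theorem exists_lintegral_greenKernel_rpow_le (N : ℕ) [NeZero N] {m σ τ : ℝ} (hm : 1 ≤ m)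
    (hmN : m * ((N : ℝ) - 2) < N) (hσ : -1 - m < σ)
    (hτ : τ < m) (hτ' : τ ≤ (2 - (N : ℝ)) * m + N + σ) :
    ∃ A : ENNReal, A ≠ ⊤ ∧ ∀ x ∈ halfSpace N,
      ∫⁻ y in halfSpace N, ENNReal.ofReal |greenKernel x y| ^ m *
        ENNReal.ofReal (h (y (lastIdx N))) ^ σ ≤ A * ENNReal.ofReal (h (x (lastIdx N))) ^ τ := by
  have hN : (1 : ℝ) ≤ N := by exact_mod_cast NeZero.one_le (n := N)
  have hm0 : 0 < m := by linarith
  obtain ⟨l, hl1, hl2⟩ : ∃ l : ℝ, max 0 ((N : ℝ) - 2) < l ∧ l < N / m := by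
    refine exists_between (max_lt (by positivity) ?_)
    rw [lt_div_iff₀ hm0]; linarith
  obtain ⟨hl0, hl3⟩ := max_lt_iff.1 hl1
  have hlm : l * m < N := (lt_div_iff₀ hm0).1 hl2
  have hlN : l ≤ N := by nlinarith
  have hθ : (N : ℝ) - 2 + 2 * ((l - (N - 2)) / 2) = l := by ring
  obtain ⟨C₁, hC₁, hnear⟩ := exists_near_bound N (m := m) (σ := σ) (θ := (l - ((N : ℝ) - 2)) / 2)
    hm (by linarith) (by linarith) (by rw [hθ]; exact hl0)
  obtain ⟨C₂, hC₂, hfar⟩ := exists_far_kernel_bound N hm hσ hτ hτ'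
  rw [hθ] at hnear
  set ε := (m - τ) / 2 with hε
  have hε0 : 0 < ε := by rw [hε]; linarith
  set Φ : EuclideanSpace ℝ (Fin N) → ℝ := fun z => nearProfile N (l * m) z + farProfile N ε z
  set Ψ : EuclideanSpace ℝ (Fin N) → ℝ := boundaryProfile N (m + σ) (ε / N)
  have hΦ : Integrable Φ := (integrable_nearProfile hlm).add (integrable_farProfile hε0)
  have hΨ : Integrable Ψ := integrable_boundaryProfile (by linarith) (by positivity)
  have hΦ0 : ∀ z, 0 ≤ Φ z := fun z => add_nonneg (nearProfile_nonneg _ _) (farProfile_nonneg _ _)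
  have hΨ0 : ∀ z, 0 ≤ Ψ z := fun z => boundaryProfile_nonneg _ _ _
  set C := C₁ + C₂ with hC
  have hC0 : 0 < C := by positivity
  have hpt : ∀ x ∈ halfSpace N, ∀ y ∈ halfSpace N, x ≠ y →
      |greenKernel x y| ^ m * h (y (lastIdx N)) ^ σ ≤ C * h (x (lastIdx N)) ^ (τ - N) *
        (Φ ((h (x (lastIdx N)))⁻¹ • (y - x)) +
          Ψ ((h (x (lastIdx N)))⁻¹ • (y - boundaryProj x))) := by
    intro x hx y hy hxy
    have hρ0 : 0 < h (x (lastIdx N)) := h_pos hx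
    have hρ1 := h_le_one (x (lastIdx N))
    have hn := nearProfile_nonneg (l * m) ((h (x (lastIdx N)))⁻¹ • (y - x))
    have hf := farProfile_nonneg ε ((h (x (lastIdx N)))⁻¹ • (y - x))
    have hb := hΨ0 ((h (x (lastIdx N)))⁻¹ • (y - boundaryProj x))
    rcases le_total ‖x - y‖ (h (x (lastIdx N)) / 2) with hr | hr
    · have hpow : h (x (lastIdx N)) ^ ((2 - (N : ℝ)) * m + σ) ≤ h (x (lastIdx N)) ^ (τ - N) :=
        Real.rpow_le_rpow_of_exponent_ge hρ0 hρ1 (by linarith)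
      refine (hnear x hx y hy hxy hr).trans ?_
      rw [mul_assoc]
      gcongr
      · exact le_add_of_nonneg_right hC₂.le
      · exact (le_add_of_nonneg_right hf).trans (le_add_of_nonneg_right hb)
    · refine (hfar x hx y hy hxy hr).trans ?_
      rw [mul_assoc]
      gcongr
      · exact le_add_of_nonneg_left hC₁.le
      · exact le_add_of_nonneg_left hn
  refine ⟨ENNReal.ofReal (C * (∫ z, Φ z) + C * ∫ z, Ψ z), ENNReal.ofReal_ne_top, fun x hx => ?_⟩
  set ρ := h (x (lastIdx N)) with hρ
  have hρ0 : 0 < ρ := h_pos hx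
  have hne : ∀ᵐ y ∂(volume.restrict (halfSpace N)), y ≠ x :=
    ae_restrict_of_ae (by simp [ae_iff, measure_singleton])
  have hmem : ∀ᵐ y ∂(volume.restrict (halfSpace N)), y ∈ halfSpace N := by
    refine ae_restrict_mem ?_
    exact measurableSet_lt measurable_const (by fun_prop)
  have hle : ∫⁻ y in halfSpace N, ENNReal.ofReal |greenKernel x y| ^ m *
        ENNReal.ofReal (h (y (lastIdx N))) ^ σ ≤
      ∫⁻ y, ENNReal.ofReal (C * ρ ^ (τ - N)) * (ENNReal.ofReal (Φ (ρ⁻¹ • (y - x))) +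
          ENNReal.ofReal (Ψ (ρ⁻¹ • (y - boundaryProj x)))) := by
    refine (lintegral_mono_ae ?_).trans (setLIntegral_le_lintegral _ _)
    filter_upwards [hne, hmem] with y hyx hy
    rw [ENNReal.ofReal_rpow_of_nonneg (abs_nonneg _) hm0.le, ENNReal.ofReal_rpow_of_pos (h_pos hy),
      ← ENNReal.ofReal_mul (by positivity), ← ENNReal.ofReal_add (hΦ0 _) (hΨ0 _),
      ← ENNReal.ofReal_mul (by positivity)]
    exact ENNReal.ofReal_le_ofReal (hpt x hx y hy hyx.symm)
  refine hle.trans_eq ?_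
  have hmeas : AEMeasurable (fun y => ENNReal.ofReal (Φ (ρ⁻¹ • (y - x)))) :=
    ((hΦ.comp_smul (by positivity : ρ⁻¹ ≠ 0)).comp_sub_right x).aestronglyMeasurable.aemeasurable.ennreal_ofReal
  rw [lintegral_const_mul' _ _ ENNReal.ofReal_ne_top, lintegral_add_left' hmeas,
    lintegral_ofReal_comp_scale hΦ hΦ0 hρ0, lintegral_ofReal_comp_scale hΨ hΨ0 hρ0]
  have hIΦ : 0 ≤ ∫ z, Φ z := integral_nonneg hΦ0
  have hIΨ : 0 ≤ ∫ z, Ψ z := integral_nonneg hΨ0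
  rw [← ENNReal.ofReal_add (by positivity) (by positivity), ← ENNReal.ofReal_mul (by positivity),
    ENNReal.ofReal_rpow_of_pos hρ0, ← ENNReal.ofReal_mul (by positivity), Real.rpow_sub hρ0]
  congr 1
  field_simp

end HalfSpaceGreen

namespace HalfSpaceGreen

/-- A weighted Young inequality of Schur type. -/
theorem lintegral_rpow_lintegral_mul_le {X Y : Type*} [MeasurableSpace X] [MeasurableSpace Y]
    {μ : Measure X} {ν : Measure Y} [SFinite μ] [SFinite ν] {q r m : ℝ} (hq : 1 < q) (hqr : q ≤ r)
    (hm : 1 / m = 1 + 1 / r - 1 / q)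
    {K : X → Y → ENNReal} (hK : Measurable (Function.uncurry K))
    {F : Y → ENNReal} (hF : AEMeasurable F ν) {u : Y → ENNReal} (hu : Measurable u)
    (hu0 : ∀ᵐ y ∂ν, u y ≠ 0) (hu1 : ∀ᵐ y ∂ν, u y ≠ ⊤) {v : X → ENNReal} (hv : Measurable v)
    {A B : ENNReal}
    (hA : ∀ᵐ x ∂μ, ∫⁻ y, K x y ^ m * u y ∂ν ≤ A * v x)
    (hB : ∀ᵐ y ∂ν, ∫⁻ x, K x y ^ m * v x ^ (r * (1 - 1 / q)) ∂μ ≤ B * u y ^ (r * (1 - 1 / q))) :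
    ∫⁻ x, (∫⁻ y, K x y * F y ∂ν) ^ r ∂μ ≤
      A ^ (r * (1 - 1 / q)) * B * (∫⁻ y, F y ^ q ∂ν) ^ (r / q) := by
  set s := r * (1 - 1 / q) with hs
  have hq0 : 0 < q := by linarith
  have hr0 : 0 < r := by linarith
  have h1q : 1 / q < 1 := by rw [div_lt_one hq0]; exact hq
  have h1r : 1 / r ≤ 1 / q := one_div_le_one_div_of_le hq0 hqr
  have hr1 : 0 < 1 / r := by positivity
  have hs0 : 0 ≤ s := mul_nonneg hr0.le (by linarith)
  have hmpos : 0 < m := by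
    rw [← one_div_pos, hm]; linarith
  have hm1 : m * (1 / r) + m * (1 - 1 / q) = 1 := by
    rw [← mul_add, show 1 / r + (1 - 1 / q) = 1 / m by rw [hm]; ring]
    field_simp
  have hsr : s * (1 / r) = 1 - 1 / q := by rw [hs]; field_simp
  have hqq : q * (1 / r) + q * (1 / q - 1 / r) = 1 := by field_simp; ring
  have hKy : ∀ x, Measurable (K x) := fun x => hK.of_uncurry_left
  have hpt : ∀ x, ∀ᵐ y ∂ν, K x y * F y =
      (K x y ^ m * F y ^ q * (u y ^ s)⁻¹) ^ (1 / r) * (K x y ^ m * u y) ^ (1 - 1 / q) *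
        (F y ^ q) ^ (1 / q - 1 / r) := by
    intro x
    filter_upwards [hu0, hu1] with y h0 h1
    have h2 : ((u y ^ s)⁻¹) ^ (1 / r) * u y ^ (1 - 1 / q) = 1 := by
      rw [ENNReal.inv_rpow, ← ENNReal.rpow_mul, hsr]
      exact ENNReal.inv_mul_cancel (by simp [h0, h1]) (by simp [h0, h1])
    have h3 : (K x y ^ m) ^ (1 / r) * (K x y ^ m) ^ (1 - 1 / q) = K x y := by
      rw [← ENNReal.rpow_mul, ← ENNReal.rpow_mul, ← ENNReal.rpow_add_of_nonneg _ _ (by positivity)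
        (mul_nonneg hmpos.le (by linarith)), hm1, ENNReal.rpow_one]
    have h4 : (F y ^ q) ^ (1 / r) * (F y ^ q) ^ (1 / q - 1 / r) = F y := by
      rw [← ENNReal.rpow_mul, ← ENNReal.rpow_mul, ← ENNReal.rpow_add_of_nonneg _ _ (by positivity)
        (mul_nonneg hq0.le (by linarith)), hqq, ENNReal.rpow_one]
    rw [ENNReal.mul_rpow_of_nonneg _ _ hr1.le, ENNReal.mul_rpow_of_nonneg _ _ hr1.le,
      ENNReal.mul_rpow_of_nonneg _ _ (by linarith : 0 ≤ 1 - 1 / q)]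
    calc K x y * F y = ((K x y ^ m) ^ (1 / r) * (K x y ^ m) ^ (1 - 1 / q)) *
          ((F y ^ q) ^ (1 / r) * (F y ^ q) ^ (1 / q - 1 / r)) *
          (((u y ^ s)⁻¹) ^ (1 / r) * u y ^ (1 - 1 / q)) := by rw [h2, h3, h4, mul_one]
      _ = _ := by ring
  set T := ∫⁻ y, F y ^ q ∂ν with hT
  have hmeas1 : ∀ x, AEMeasurable (fun y => K x y ^ m * F y ^ q * (u y ^ s)⁻¹) ν := fun x =>
    ((((hKy x).pow_const m).aemeasurable.mul (hF.pow_const q))).mul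
      (hu.pow_const s).inv.aemeasurable
  have hholder : ∀ x, ∫⁻ y, K x y * F y ∂ν ≤
      (∫⁻ y, K x y ^ m * F y ^ q * (u y ^ s)⁻¹ ∂ν) ^ (1 / r) *
        (∫⁻ y, K x y ^ m * u y ∂ν) ^ (1 - 1 / q) * T ^ (1 / q - 1 / r) := by
    intro x
    rw [lintegral_congr_ae (hpt x)]
    have := ENNReal.lintegral_prod_norm_pow_le (μ := ν) (Finset.univ : Finset (Fin 3))
      (f := ![fun y => K x y ^ m * F y ^ q * (u y ^ s)⁻¹, fun y => K x y ^ m * u y,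
        fun y => F y ^ q]) (p := ![1 / r, 1 - 1 / q, 1 / q - 1 / r])
      (by
        intro i _
        fin_cases i
        · exact hmeas1 x
        · exact (((hKy x).pow_const m).mul hu).aemeasurable
        · exact hF.pow_const q)
      (by simp [Fin.sum_univ_three]; ring)
      (by
        intro i _
        fin_cases i
        · exact hr1.le
        · exact (by linarith : 0 ≤ 1 - 1 / q)
        · exact (by linarith : 0 ≤ 1 / q - 1 / r))
    simpa [Fin.prod_univ_three] using this
  have hstep : ∀ᵐ x ∂μ, (∫⁻ y, K x y * F y ∂ν) ^ r ≤
      A ^ s * T ^ (r / q - 1) *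
        ∫⁻ y, K x y ^ m * v x ^ s * (F y ^ q * (u y ^ s)⁻¹) ∂ν := by
    filter_upwards [hA] with x hx
    refine (ENNReal.rpow_le_rpow (hholder x) hr0.le).trans ?_
    rw [ENNReal.mul_rpow_of_nonneg _ _ hr0.le, ENNReal.mul_rpow_of_nonneg _ _ hr0.le,
      ← ENNReal.rpow_mul, ← ENNReal.rpow_mul, ← ENNReal.rpow_mul, one_div_mul_cancel hr0.ne',
      ENNReal.rpow_one, mul_comm (1 - 1 / q) r,
      show (1 / q - 1 / r) * r = r / q - 1 by field_simp]
    have h5 : (∫⁻ y, K x y ^ m * u y ∂ν) ^ s ≤ A ^ s * v x ^ s := by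
      rw [← ENNReal.mul_rpow_of_nonneg _ _ hs0]
      exact ENNReal.rpow_le_rpow hx hs0
    have h6 : ∫⁻ y, K x y ^ m * v x ^ s * (F y ^ q * (u y ^ s)⁻¹) ∂ν =
        v x ^ s * ∫⁻ y, K x y ^ m * F y ^ q * (u y ^ s)⁻¹ ∂ν := by
      rw [← lintegral_const_mul'' _ (hmeas1 x)]
      exact lintegral_congr fun y => by ring
    rw [h6]
    calc _ ≤ (∫⁻ y, K x y ^ m * F y ^ q * (u y ^ s)⁻¹ ∂ν) * (A ^ s * v x ^ s) *
          T ^ (r / q - 1) := by gcongr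
      _ = _ := by ring
  have hmeas2 : AEMeasurable (Function.uncurry fun x y =>
      K x y ^ m * v x ^ s * (F y ^ q * (u y ^ s)⁻¹)) (μ.prod ν) := by
    refine AEMeasurable.mul ((hK.pow_const m).mul ((hv.comp measurable_fst).pow_const s)).aemeasurable
      ?_
    exact ((hF.pow_const q).mul (hu.pow_const s).inv.aemeasurable).comp_snd
  have hmeas3 : AEMeasurable (fun x => ∫⁻ y,
      K x y ^ m * v x ^ s * (F y ^ q * (u y ^ s)⁻¹) ∂ν) μ := hmeas2.lintegral_prod_right'
  refine (lintegral_mono_ae hstep).trans ?_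
  rw [lintegral_const_mul'' _ hmeas3, lintegral_lintegral_swap hmeas2]
  have hinner : ∀ᵐ y ∂ν, ∫⁻ x, K x y ^ m * v x ^ s * (F y ^ q * (u y ^ s)⁻¹) ∂μ ≤ B * F y ^ q := by
    filter_upwards [hB, hu0, hu1] with y hy h0 h1
    have hm' : Measurable fun x => K x y ^ m * v x ^ s :=
      (hK.of_uncurry_right.pow_const m).mul (hv.pow_const s)
    rw [lintegral_mul_const _ hm']
    calc _ ≤ B * u y ^ s * (F y ^ q * (u y ^ s)⁻¹) := by gcongr
      _ = B * F y ^ q * (u y ^ s * (u y ^ s)⁻¹) := by ring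
      _ = _ := by rw [ENNReal.mul_inv_cancel (by simp [h0, h1]) (by simp [h0, h1]), mul_one]
  have hfin : ∫⁻ y, ∫⁻ x, K x y ^ m * v x ^ s * (F y ^ q * (u y ^ s)⁻¹) ∂μ ∂ν ≤ B * T := by
    rw [hT, ← lintegral_const_mul'' _ (hF.pow_const q)]
    exact lintegral_mono_ae hinner
  have hrq : 0 ≤ r / q - 1 := by rw [sub_nonneg, le_div_iff₀ hq0]; linarith
  calc _ ≤ A ^ s * T ^ (r / q - 1) * (B * T) := by gcongr
    _ = A ^ s * B * (T ^ (r / q - 1) * T ^ (1 : ℝ)) := by rw [ENNReal.rpow_one]; ring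
    _ = _ := by rw [← ENNReal.rpow_add_of_nonneg _ _ hrq zero_le_one, sub_add_cancel]

end HalfSpaceGreen

namespace HalfSpaceGreen

variable {N : ℕ} [NeZero N]

lemma measurable_h : Measurable h := measurable_id.min measurable_const

lemma measurableSet_halfSpace : MeasurableSet (halfSpace N) :=
  measurableSet_lt measurable_const (by fun_prop)

lemma measurable_besselK (ν : ℝ) : Measurable (besselK ν) := by
  have : StronglyMeasurable (Function.uncurry fun r t : ℝ =>
      Real.exp (-(r * Real.cosh t)) * Real.cosh (ν * t)) := by
    refine Continuous.stronglyMeasurable ?_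
    unfold Function.uncurry
    fun_prop
  exact (this.integral_prod_right (ν := volume.restrict (Set.Ioi 0))).measurable

lemma measurable_fundSol (N : ℕ) : Measurable (fundSol N) := by
  unfold fundSol
  exact (measurable_const.mul (measurable_id.pow_const _)).mul (measurable_besselK _)

lemma measurable_uncurry_greenKernel :
    Measurable (Function.uncurry (greenKernel (N := N))) := by
  have h1 : ∀ z : EuclideanSpace ℝ (Fin N) × EuclideanSpace ℝ (Fin N), ‖reflect z.1 - z.2‖ =
      Real.sqrt (‖z.1 - z.2‖ ^ 2 + 4 * (z.1 (lastIdx N) * z.2 (lastIdx N))) := fun z => by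
    rw [← norm_reflect_sub_sq, Real.sqrt_sq (norm_nonneg _)]
  have h2 : Measurable fun z : EuclideanSpace ℝ (Fin N) × EuclideanSpace ℝ (Fin N) =>
      ‖reflect z.1 - z.2‖ := by
    simp only [h1]
    refine Continuous.measurable ?_
    fun_prop
  exact ((measurable_fundSol N).comp (by fun_prop :
    Measurable fun z : EuclideanSpace ℝ (Fin N) × EuclideanSpace ℝ (Fin N) =>
      ‖z.1 - z.2‖)).sub ((measurable_fundSol N).comp h2)

/-- The weight `h(x_N)` as an extended nonnegative real. -/
noncomputable def weight (x : EuclideanSpace ℝ (Fin N)) : ENNReal :=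
  ENNReal.ofReal (h (x (lastIdx N)))

lemma measurable_weight : Measurable (weight (N := N)) :=
  (measurable_h.comp (by fun_prop)).ennreal_ofReal

lemma weight_ne_zero {x : EuclideanSpace ℝ (Fin N)} (hx : x ∈ halfSpace N) : weight x ≠ 0 :=
  (ENNReal.ofReal_pos.2 (h_pos hx)).ne'

lemma weight_ne_top (x : EuclideanSpace ℝ (Fin N)) : weight x ≠ ⊤ := ENNReal.ofReal_ne_top

lemma weight_rpow {x : EuclideanSpace ℝ (Fin N)} (hx : x ∈ halfSpace N) (a : ℝ) :
    weight x ^ a = ENNReal.ofReal (h (x (lastIdx N)) ^ a) :=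
  ENNReal.ofReal_rpow_of_pos (h_pos hx)

lemma weight_rpow_ne_top {x : EuclideanSpace ℝ (Fin N)} (hx : x ∈ halfSpace N) (a : ℝ) :
    weight x ^ a ≠ ⊤ := by
  rw [weight_rpow hx]; exact ENNReal.ofReal_ne_top

lemma enorm_h_rpow_mul {x : EuclideanSpace ℝ (Fin N)} (hx : x ∈ halfSpace N) (a t : ℝ) :
    ‖h (x (lastIdx N)) ^ a * t‖ₑ = weight x ^ a * ‖t‖ₑ := by
  have := h_pos hx
  rw [enorm_mul, weight_rpow hx, Real.enorm_of_nonneg (by positivity)]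

lemma aestronglyMeasurable_of_h_rpow_mul {a : ℝ} {f : EuclideanSpace ℝ (Fin N) → ℝ}
    (hf : AEStronglyMeasurable (fun x => h (x (lastIdx N)) ^ a * f x)
      (volume.restrict (halfSpace N))) :
    AEStronglyMeasurable f (volume.restrict (halfSpace N)) := by
  have h1 : Measurable fun x : EuclideanSpace ℝ (Fin N) => h (x (lastIdx N)) ^ (-a) :=
    (measurable_h.comp (by fun_prop)).pow_const _
  refine (h1.aestronglyMeasurable.mul hf).congr ?_
  filter_upwards [ae_restrict_mem measurableSet_halfSpace] with x hx
  have := h_pos hx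
  simp only [Pi.mul_apply]
  rw [← mul_assoc, ← Real.rpow_add this]
  simp

lemma lqNorm_eq_lintegral {q a : ℝ} (hq : 0 < q) {f : EuclideanSpace ℝ (Fin N) → ℝ}
    (hf : AEStronglyMeasurable f (volume.restrict (halfSpace N))) :
    lqNorm q a f =
      (∫⁻ x in halfSpace N, (weight x ^ a * ‖f x‖ₑ) ^ q).toReal ^ (1 / q) := by
  have hmeas : AEStronglyMeasurable (fun x => |f x| ^ q * h (x (lastIdx N)) ^ (q * a))
      (volume.restrict (halfSpace N)) := by
    have h1 : Measurable fun x : EuclideanSpace ℝ (Fin N) => h (x (lastIdx N)) ^ (q * a) :=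
      (measurable_h.comp (by fun_prop)).pow_const _
    exact ((hf.aemeasurable.abs.pow_const q).mul h1.aemeasurable).aestronglyMeasurable
  rw [lqNorm, integral_eq_lintegral_of_nonneg_ae _ hmeas]
  · congr 2
    refine setLIntegral_congr_fun measurableSet_halfSpace fun x hx => ?_
    have := h_pos hx
    simp only
    rw [ENNReal.mul_rpow_of_nonneg _ _ hq.le, ← ENNReal.rpow_mul, weight_rpow hx,
      Real.enorm_eq_ofReal_abs, ENNReal.ofReal_rpow_of_nonneg (abs_nonneg _) hq.le,
      ← ENNReal.ofReal_mul (by positivity), mul_comm, mul_comm a q]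
  · filter_upwards [ae_restrict_mem measurableSet_halfSpace] with x hx
    have := h_pos hx
    simp only [Pi.zero_apply]
    positivity

lemma lintegral_weight_rpow_lt_top {q a : ℝ} (hq : 0 < q) {f : EuclideanSpace ℝ (Fin N) → ℝ}
    (hf : MemLp (fun x => h (x (lastIdx N)) ^ a * f x) (ENNReal.ofReal q)
      (volume.restrict (halfSpace N))) :
    ∫⁻ x in halfSpace N, (weight x ^ a * ‖f x‖ₑ) ^ q < ⊤ := by
  have h1 := lintegral_rpow_enorm_lt_top_of_eLpNorm_lt_top (by simpa using hq)
    ENNReal.ofReal_ne_top hf.2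
  rw [ENNReal.toReal_ofReal hq.le] at h1
  rwa [setLIntegral_congr_fun measurableSet_halfSpace
    (g := fun x => ‖h (x (lastIdx N)) ^ a * f x‖ₑ ^ q)
    fun x hx => by simp only; rw [enorm_h_rpow_mul hx]]

lemma memLqWeighted_of_lintegral_lt_top {r b : ℝ} (hr : 0 < r)
    {g : EuclideanSpace ℝ (Fin N) → ℝ}
    (hg : AEStronglyMeasurable g (volume.restrict (halfSpace N)))
    (hfin : ∫⁻ x in halfSpace N, (weight x ^ b * ‖g x‖ₑ) ^ r < ⊤) : MemLqWeighted r b g := by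
  have hm : MemLp (fun x => h (x (lastIdx N)) ^ b * g x) (ENNReal.ofReal r)
      (volume.restrict (halfSpace N)) := by
    have h1 : Measurable fun x : EuclideanSpace ℝ (Fin N) => h (x (lastIdx N)) ^ b :=
      (measurable_h.comp (by fun_prop)).pow_const _
    refine ⟨h1.aestronglyMeasurable.mul hg, ?_⟩
    rw [eLpNorm_lt_top_iff_lintegral_rpow_enorm_lt_top (by simpa using hr) ENNReal.ofReal_ne_top,
      ENNReal.toReal_ofReal hr.le]
    rwa [setLIntegral_congr_fun measurableSet_halfSpace
      (g := fun x => (weight x ^ b * ‖g x‖ₑ) ^ r)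
      fun x hx => by simp only; rw [enorm_h_rpow_mul hx]]
  refine ⟨fun K hK hKs => ?_, hm⟩
  have hcont : ContinuousOn (fun x : EuclideanSpace ℝ (Fin N) => h (x (lastIdx N)) ^ (-b)) K := by
    refine ContinuousOn.rpow_const ?_ fun x hx => Or.inl (h_pos (hKs hx)).ne'
    unfold h
    fun_prop
  obtain ⟨c, hc⟩ := hK.exists_bound_of_continuousOn hcont
  have hle : volume.restrict K ≤ volume.restrict (halfSpace N) := Measure.restrict_mono hKs le_rfl
  refine (hm.mono_measure hle).of_le_mul (c := c) (hg.mono_measure hle) ?_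
  filter_upwards [ae_restrict_mem hK.measurableSet] with x hx
  have h0 := h_pos (hKs hx)
  have h1 : g x = h (x (lastIdx N)) ^ (-b) * (h (x (lastIdx N)) ^ b * g x) := by
    rw [← mul_assoc, ← Real.rpow_add h0]; simp
  conv_lhs => rw [h1, norm_mul]
  exact mul_le_mul_of_nonneg_right (hc x hx) (norm_nonneg _)

/-- The exponent of the auxiliary weight in the Schur test. -/
lemma exists_schur_exponent {N q r m α β : ℝ} (hN : 0 < N) (hq : 1 < q) (hqr : q ≤ r)
    (hm0 : 0 < m) (hm : 1 / m = 1 + 1 / r - 1 / q) (hα : 1 / q + α < 2) (hβ : 1 / r + β > -1)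
    (hscale : N / r + β ≥ N / q + α - 2) :
    ∃ b : ℝ, -1 - m < b - α * m ∧ b - β * m < m ∧
      -1 - m < β * m + b * (r * (1 - 1 / q)) ∧ α * m + b * (r * (1 - 1 / q)) < m := by
  have hq0 : 0 < q := by linarith
  have hr0 : 0 < r := by linarith
  have h1q : 1 / q < 1 := by rw [div_lt_one hq0]; exact hq
  set s := r * (1 - 1 / q) with hs
  have hs0 : 0 < s := mul_pos hr0 (by linarith)
  have hsm : (s + 1) * m = r := by
    have : 1 / m = (s + 1) / r := by rw [hm, hs]; field_simp; ring
    rw [div_eq_div_iff hm0.ne' hr0.ne', one_mul] at this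
    exact this.symm
  have hNqr : N / r ≤ N / q := div_le_div_of_nonneg_left hN.le hq0 hqr
  have h1 : (α - β - 2) * m < 1 := by nlinarith
  have hrα : r * (α - 1) < s := by rw [hs]; exact mul_lt_mul_of_pos_left (by linarith) hr0
  have hrβ : -1 < r * (1 + β) := by
    have h2 : -(1 / r) < 1 + β := by linarith
    have h3 := mul_lt_mul_of_pos_left h2 hr0
    have h4 : r * -(1 / r) = -1 := by field_simp
    linarith
  have hαm : m * ((α - 1) * (s + 1)) < s := by
    have : m * ((α - 1) * (s + 1)) = (α - 1) * ((s + 1) * m) := by ring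
    rw [this, hsm]; linarith
  have hβm : -1 < m * ((1 + β) * (s + 1)) := by
    have : m * ((1 + β) * (s + 1)) = (1 + β) * ((s + 1) * m) := by ring
    rw [this, hsm]; linarith
  obtain ⟨b, hb1, hb2⟩ : ∃ b : ℝ, max (α * m - m - 1) (-(1 + m + β * m) / s) < b ∧
      b < min ((1 + β) * m) ((1 - α) * m / s) := by
    refine exists_between (max_lt (lt_min ?_ ?_) (lt_min ?_ ?_))
    · linarith
    · rw [lt_div_iff₀ hs0]; linarith
    · rw [div_lt_iff₀ hs0]; linarith
    · refine div_lt_div_of_pos_right ?_ hs0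
      linarith
  obtain ⟨h3, h4⟩ := max_lt_iff.1 hb1
  obtain ⟨h5, h6⟩ := lt_min_iff.1 hb2
  rw [div_lt_iff₀ hs0] at h4
  rw [lt_div_iff₀ hs0] at h6
  exact ⟨b, by linarith, by linarith, by linarith, by linarith⟩

/-- The weighted estimate for the absolute Green potential. -/
theorem exists_lintegral_greenPotential_le (N : ℕ) [NeZero N] {q r α β : ℝ}
    (hq : 1 < q) (hqr : q ≤ r) (hα : 1 / q + α < 2) (hβ : 1 / r + β > -1)
    (hgap : 1 / q - 1 / r < 2 / (N : ℝ)) (hscale : (N : ℝ) / r + β ≥ (N : ℝ) / q + α - 2) :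
    ∃ D : ENNReal, D ≠ ⊤ ∧ ∀ f : EuclideanSpace ℝ (Fin N) → ℝ,
      AEStronglyMeasurable f (volume.restrict (halfSpace N)) →
      ∫⁻ x in halfSpace N, (weight x ^ β * ∫⁻ y in halfSpace N, ‖greenKernel x y * f y‖ₑ) ^ r ≤
        D * (∫⁻ y in halfSpace N, (weight y ^ α * ‖f y‖ₑ) ^ q) ^ (r / q) := by
  have hN : (1 : ℝ) ≤ N := by exact_mod_cast NeZero.one_le (n := N)
  have hN0 : (0 : ℝ) < N := by linarith
  have hq0 : 0 < q := by linarith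
  have hr0 : 0 < r := by linarith
  have h1q : 1 / q < 1 := by rw [div_lt_one hq0]; exact hq
  have h1r : 1 / r ≤ 1 / q := one_div_le_one_div_of_le hq0 hqr
  have hr1 : 0 < 1 / r := by positivity
  set m := 1 / (1 + 1 / r - 1 / q) with hmdef
  have hm : 1 / m = 1 + 1 / r - 1 / q := one_div_one_div _
  have hm0 : 0 < m := one_div_pos.2 (by linarith)
  have hm1 : 1 ≤ m := by rw [hmdef, le_div_iff₀ (by linarith)]; linarith
  have hmm : m * (1 + 1 / r - 1 / q) = 1 := by rw [← hm]; field_simp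
  have hmN : m * ((N : ℝ) - 2) < N := by
    have h1 : ((N : ℝ) - 2) < N * (1 / m) := by
      rw [hm]
      have h2 := mul_lt_mul_of_pos_left hgap hN0
      rw [mul_div_cancel₀ _ hN0.ne'] at h2
      linarith
    have h3 := mul_lt_mul_of_pos_left h1 hm0
    have h4 : m * (N * (1 / m)) = N := by field_simp
    linarith
  have hD : 0 ≤ (2 - (N : ℝ)) * m + N + β * m - α * m := by
    have h1 : (2 - (N : ℝ)) * m + N + β * m - α * m =
        m * (2 + N / r - N / q + β - α) := by
      have : (N : ℝ) = N * (m * (1 + 1 / r - 1 / q)) := by rw [hmm, mul_one]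
      calc _ = (2 - (N : ℝ)) * m + N * (m * (1 + 1 / r - 1 / q)) + β * m - α * m := by
            rw [← this]
        _ = _ := by ring
    rw [h1]
    exact mul_nonneg hm0.le (by linarith)
  obtain ⟨b, hb1, hb2, hb3, hb4⟩ := exists_schur_exponent hN0 hq hqr hm0 hm hα hβ hscale
  set s := r * (1 - 1 / q) with hs
  have hs0 : 0 < s := mul_pos hr0 (by linarith)
  obtain ⟨A, hA, hAb⟩ := exists_lintegral_greenKernel_rpow_le N hm1 hmN hb1 hb2 (by linarith)
  obtain ⟨B, hB, hBb⟩ := exists_lintegral_greenKernel_rpow_le N hm1 hmN hb3 hb4 (by linarith)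
  refine ⟨A ^ s * B, ENNReal.mul_ne_top (ENNReal.rpow_ne_top_of_nonneg hs0.le hA) hB,
    fun f hf => ?_⟩
  set K : EuclideanSpace ℝ (Fin N) → EuclideanSpace ℝ (Fin N) → ENNReal := fun x y =>
    weight x ^ β * ENNReal.ofReal |greenKernel x y| * weight y ^ (-α) with hKdef
  have hGm : Measurable fun z : EuclideanSpace ℝ (Fin N) × EuclideanSpace ℝ (Fin N) =>
      ENNReal.ofReal |greenKernel z.1 z.2| :=
    (continuous_abs.measurable.comp measurable_uncurry_greenKernel).ennreal_ofReal
  have hK : Measurable (Function.uncurry K) :=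
    (((measurable_weight.comp measurable_fst).pow_const β).mul hGm).mul
      ((measurable_weight.comp measurable_snd).pow_const (-α))
  have hKm : ∀ x y, K x y ^ m = weight x ^ (β * m) * ENNReal.ofReal |greenKernel x y| ^ m *
      weight y ^ (-α * m) := fun x y => by
    rw [hKdef, ENNReal.mul_rpow_of_nonneg _ _ hm0.le, ENNReal.mul_rpow_of_nonneg _ _ hm0.le,
      ← ENNReal.rpow_mul, ← ENNReal.rpow_mul]
  have hmem := ae_restrict_mem (μ := volume) (measurableSet_halfSpace (N := N))
  have hmain := lintegral_rpow_lintegral_mul_le (μ := volume.restrict (halfSpace N))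
    (ν := volume.restrict (halfSpace N)) hq hqr hm hK
    (F := fun y => weight y ^ α * ‖f y‖ₑ) (u := fun y => weight y ^ b)
    (v := fun x => weight x ^ b) (A := A) (B := B)
    ((measurable_weight.pow_const α).aemeasurable.mul hf.enorm)
    (measurable_weight.pow_const b)
    (by
      filter_upwards [hmem] with y hy
      exact (ENNReal.rpow_pos (pos_iff_ne_zero.2 (weight_ne_zero hy)) (weight_ne_top y)).ne')
    (by
      filter_upwards [hmem] with y hy
      exact weight_rpow_ne_top hy _)
    (measurable_weight.pow_const b)
    (by
      filter_upwards [hmem] with x hx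
      have h1 : ∫⁻ y in halfSpace N, K x y ^ m * weight y ^ b = weight x ^ (β * m) *
          ∫⁻ y in halfSpace N, ENNReal.ofReal |greenKernel x y| ^ m * weight y ^ (b - α * m) := by
        rw [← lintegral_const_mul' _ _
          (weight_rpow_ne_top hx _)]
        refine setLIntegral_congr_fun measurableSet_halfSpace fun y hy => ?_
        rw [hKm, sub_eq_neg_add b, ENNReal.rpow_add _ _ (weight_ne_zero hy) (weight_ne_top y),
          neg_mul]
        ring
      rw [h1]
      calc _ ≤ weight x ^ (β * m) * (A * weight x ^ (b - β * m)) := by gcongr; exact hAb x hx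
        _ = A * (weight x ^ (β * m) * weight x ^ (b - β * m)) := by ring
        _ = _ := by
          rw [← ENNReal.rpow_add _ _ (weight_ne_zero hx) (weight_ne_top x), add_sub_cancel])
    (by
      filter_upwards [hmem] with y hy
      have h1 : ∫⁻ x in halfSpace N, K x y ^ m * (weight x ^ b) ^ s = weight y ^ (-α * m) *
          ∫⁻ x in halfSpace N, ENNReal.ofReal |greenKernel y x| ^ m *
            weight x ^ (β * m + b * s) := by
        rw [← lintegral_const_mul' _ _
          (weight_rpow_ne_top hy _)]
        refine setLIntegral_congr_fun measurableSet_halfSpace fun x hx => ?_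
        rw [hKm, ENNReal.rpow_add _ _ (weight_ne_zero hx) (weight_ne_top x), ENNReal.rpow_mul _ b,
          greenKernel_comm]
        ring
      rw [← hs, h1, ← ENNReal.rpow_mul]
      calc _ ≤ weight y ^ (-α * m) * (B * weight y ^ (α * m + b * s)) := by
            gcongr; exact hBb y hy
        _ = B * (weight y ^ (-α * m) * weight y ^ (α * m + b * s)) := by ring
        _ = _ := by
          rw [← ENNReal.rpow_add _ _ (weight_ne_zero hy) (weight_ne_top y)]
          congr 2
          ring)
  refine le_trans (le_of_eq ?_) hmain
  refine setLIntegral_congr_fun measurableSet_halfSpace fun x hx => ?_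
  congr 1
  rw [← lintegral_const_mul' _ _ (weight_rpow_ne_top hx _)]
  refine setLIntegral_congr_fun measurableSet_halfSpace fun y hy => ?_
  simp only [hKdef]
  rw [enorm_mul, Real.enorm_eq_ofReal_abs (greenKernel x y)]
  have h1 : weight y ^ (-α) * weight y ^ α = 1 := by
    rw [← ENNReal.rpow_add _ _ (weight_ne_zero hy) (weight_ne_top y)]; simp
  calc _ = weight x ^ β * (ENNReal.ofReal |greenKernel x y| * ‖f y‖ₑ) *
        (weight y ^ (-α) * weight y ^ α) := by rw [h1, mul_one]
    _ = _ := by ring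

end HalfSpaceGreen

theorem proposition2p1 (N : ℕ) [NeZero N] (q r α β : ℝ)
    (hq : 1 < q) (hqr : q ≤ r)
    (hα : 1 / q + α < 2) (hβ : 1 / r + β > -1)
    (hgap : 1 / q - 1 / r < 2 / (N : ℝ))
    (hscale : (N : ℝ) / r + β ≥ (N : ℝ) / q + α - 2) :
    ∃ C : ℝ, 0 < C ∧
      ∀ f : EuclideanSpace ℝ (Fin N) → ℝ, HalfSpaceGreen.MemLqWeighted q α f →
        (∀ᵐ x ∂(volume.restrict (HalfSpaceGreen.halfSpace N)),
          IntegrableOn (fun y => HalfSpaceGreen.greenKernel x y * f y)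
            (HalfSpaceGreen.halfSpace N)) ∧
        HalfSpaceGreen.MemLqWeighted r β (HalfSpaceGreen.greenOp f) ∧
        HalfSpaceGreen.lqNorm r β (HalfSpaceGreen.greenOp f) ≤
          C * HalfSpaceGreen.lqNorm q α f := by
  open HalfSpaceGreen in
  have hq0 : 0 < q := by linarith
  have hr0 : 0 < r := by linarith
  obtain ⟨D, hD, hbound⟩ := exists_lintegral_greenPotential_le N hq hqr hα hβ hgap hscale
  refine ⟨D.toReal ^ (1 / r) + 1, by positivity, fun f hf => ?_⟩
  have hfm : AEStronglyMeasurable f (volume.restrict (halfSpace N)) :=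
    aestronglyMeasurable_of_h_rpow_mul hf.2.1
  set T := ∫⁻ y in halfSpace N, (weight y ^ α * ‖f y‖ₑ) ^ q with hT
  have hTfin : T < ⊤ := lintegral_weight_rpow_lt_top hq0 hf.2
  have hle := hbound f hfm
  have hDT : D * T ^ (r / q) ≠ ⊤ :=
    ENNReal.mul_ne_top hD (ENNReal.rpow_ne_top_of_nonneg (by positivity) hTfin.ne)
  have hGf : AEStronglyMeasurable
      (fun z : EuclideanSpace ℝ (Fin N) × EuclideanSpace ℝ (Fin N) => greenKernel z.1 z.2 * f z.2)
      ((volume.restrict (halfSpace N)).prod (volume.restrict (halfSpace N))) :=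
    measurable_uncurry_greenKernel.aestronglyMeasurable.mul hfm.comp_snd
  have hP : AEMeasurable (fun x => ∫⁻ y in halfSpace N, ‖greenKernel x y * f y‖ₑ)
      (volume.restrict (halfSpace N)) := hGf.enorm.lintegral_prod_right'
  have hint : ∀ᵐ x ∂(volume.restrict (halfSpace N)),
      IntegrableOn (fun y => greenKernel x y * f y) (halfSpace N) := by
    have h1 := ae_lt_top' (((measurable_weight.pow_const β).aemeasurable.mul hP).pow_const r)
      (hle.trans_lt hDT.lt_top).ne
    filter_upwards [h1, ae_restrict_mem measurableSet_halfSpace] with x hx hxm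
    have hGx : Measurable (greenKernel x) := measurable_uncurry_greenKernel.of_uncurry_left
    refine ⟨hGx.aestronglyMeasurable.mul hfm, ?_⟩
    have h2 : weight x ^ β * ∫⁻ y in halfSpace N, ‖greenKernel x y * f y‖ₑ < ⊤ :=
      (ENNReal.rpow_lt_top_iff_of_pos hr0).1 hx
    have h3 : weight x ^ β ≠ 0 :=
      (ENNReal.rpow_pos (pos_iff_ne_zero.2 (weight_ne_zero hxm)) (weight_ne_top x)).ne'
    exact ENNReal.lt_top_of_mul_ne_top_right h2.ne h3
  have hgm : AEStronglyMeasurable (greenOp f) (volume.restrict (halfSpace N)) :=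
    hGf.integral_prod_right'
  have hg : ∫⁻ x in halfSpace N, (weight x ^ β * ‖greenOp f x‖ₑ) ^ r ≤ D * T ^ (r / q) := by
    refine (lintegral_mono fun x => ?_).trans hle
    refine ENNReal.rpow_le_rpow ?_ hr0.le
    gcongr
    exact enorm_integral_le_lintegral_enorm _
  refine ⟨hint, memLqWeighted_of_lintegral_lt_top hr0 hgm (hg.trans_lt hDT.lt_top), ?_⟩
  rw [lqNorm_eq_lintegral hr0 hgm, lqNorm_eq_lintegral hq0 hfm, ← hT]
  have h1 := ENNReal.toReal_mono hDT hg
  rw [ENNReal.toReal_mul, ← ENNReal.toReal_rpow] at h1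
  have h2 := Real.rpow_le_rpow ENNReal.toReal_nonneg h1 (by positivity : 0 ≤ 1 / r)
  rw [Real.mul_rpow ENNReal.toReal_nonneg (by positivity), ← Real.rpow_mul ENNReal.toReal_nonneg,
    show r / q * (1 / r) = 1 / q by field_simp] at h2
  refine h2.trans ?_
  gcongr
  linarith
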